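/- Let $\{\varepsilon_t\}_{t\in\mathbb Z}$ be i.i.d. real random variables on a probability space $(\Omega,\mathcal F,P)$, and let $\alpha>0$, $\beta>0$, $\gamma\ge 0$, $\delta\in\mathbb R$. Assume: 1. (stationarity condition) $E\log\bigl(\alpha+\gamma(\varepsilon_0-\delta)^2\bigr)<\infty$ and $\beta<1$; 2. (regularity condition) the law of $\varepsilon_0$ has a continuous density $g$ with respect to Lebesgue measure, with $g(x)>0$ for all $x\in\mathbb R$ and $\sup_{x\in\mathbb R}(|x|+1)g(x)<\infty$, and $E\varepsilon_0=0$, $E\varepsilon_0^2=1$. Then the VGARCH equation $$\sigma_t^2=\alpha+\gamma(\varepsilon_{t-1}-\delta)^2+\beta\sigma_{t-1}^2,\qquad t\in\mathbb Z,$$ has a strictly stationary solution with positive values on $(\Omega,\mathcal F,P)$. Let $\{\overline\sigma_t^2\}_{t\in\mathbb Z}$ be any such solution, and suppose that $$\lambda^y_V=E\log\left|\beta-\gamma\,\varepsilon_0\,\overline\sigma_0^{-2}(\varepsilon_0-\delta)\right|>0 .$$ Put $H(y,x)=\alpha+\beta x+\gamma\,(y x^{-1/2}-\delta)^2$ for $y\in\mathbb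 R$, $x>0$. Then on an extension of $(\Omega,\mathcal F,P)$, that is, on a probability space with a measure-preserving map to $(\Omega,\mathcal F,P)$ along which the variables above are lifted, there is a process $\{\hat{\overline\sigma}{}_t^2\}_{t\ge 0}$ with positive values such that $(\overline\sigma_0^2,\hat{\overline\sigma}{}_0^2)$ is independent of $(\varepsilon_t)_{t\ge 0}$, almost surely $$\overline\sigma_t^2=H(\overline\sigma_{t-1}\varepsilon_{t-1},\overline\sigma_{t-1}^2),\qquad \hat{\overline\sigma}{}_t^2=H(\overline\sigma_{t-1}\varepsilon_{t-1},\hat{\overline\sigma}{}_{t-1}^2),\qquad t\ge 1,$$ the process $\{(\overline\sigma_t^2,\hat{\overline\sigma}{}_t^2)\}_{t\ge 0}$ is strictly stationary, and $$P\bigl(\overline\sigma_0^2=\hat{\overline\sigma}{}_0^2\bigr)=0 .$$ -/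

import Mathlib

open MeasureTheory ProbabilityTheory

universe u

/-- Strict stationarity of a process `X` indexed by `ι` (here `ℤ` or `ℕ`): all time shifts of `X`
have the same law as `X` on the path space `ι → E`. -/
def IsStrictlyStationary {Ω ι E : Type*} [MeasurableSpace Ω] [MeasurableSpace E] [Add ι]
    (X : ι → Ω → E) (P : Measure Ω) : Prop :=
  ∀ h : ι, IdentDistrib (fun ω t => X (t + h) ω) (fun ω t => X t ω) P P

/-- The innovations are independent and identically distributed real random variables. -/
structure IsIIDInnovations {Ω : Type*} [MeasurableSpace Ω] (P : Measure Ω)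
    (ε : ℤ → Ω → ℝ) : Prop where
  measurable : ∀ t, Measurable (ε t)
  indep : iIndepFun ε P
  identDistrib : ∀ t, IdentDistrib (ε t) (ε 0) P P

/-- The regularity condition on the law of a random variable `e`: a continuous, everywhere positive
density `g` with `sup (|x| + 1) g x < ∞`, mean `0` and second moment `1`. -/
structure RegularInnovation {Ω : Type*} [MeasurableSpace Ω] (P : Measure Ω)
    (e : Ω → ℝ) : Prop where
  exists_density : ∃ g : ℝ → ℝ, Continuous g ∧ (∀ x, 0 < g x) ∧
    BddAbove (Set.range fun x => (|x| + 1) * g x) ∧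
    P.map e = volume.withDensity fun x => ENNReal.ofReal (g x)
  memLp_two : MemLp e 2 P
  mean_eq_zero : ∫ ω, e ω ∂P = 0
  second_moment_eq_one : ∫ ω, e ω ^ 2 ∂P = 1

/-- The stationarity condition for VGARCH. The logarithm is bounded below (by `log α`) when
`0 < α` and `0 ≤ γ`, so its expectation is `< ∞` exactly when it is integrable. -/
structure VGARCHStationarityCondition {Ω : Type*} [MeasurableSpace Ω] (P : Measure Ω)
    (e : Ω → ℝ) (α β γ δ : ℝ) : Prop where
  log_integrable : Integrable (fun ω => Real.log (α + γ * (e ω - δ) ^ 2)) P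
  beta_lt_one : β < 1

/-- A strictly stationary solution of the VGARCH equation
`σ_t² = α + γ (ε_{t-1} - δ)² + β σ_{t-1}²`, `t ∈ ℤ`. The process `v` is the squared volatility
`σ²`; the returns are `y_t = σ_t ε_t` with `σ_t = √(v t)`. -/
structure IsStationaryVGARCH {Ω : Type*} [MeasurableSpace Ω] (P : Measure Ω)
    (ε : ℤ → Ω → ℝ) (α β γ δ : ℝ) (v : ℤ → Ω → ℝ) : Prop where
  measurable : ∀ t, Measurable (v t)
  pos : ∀ᵐ ω ∂P, ∀ t, 0 < v t ω
  evolution : ∀ᵐ ω ∂P, ∀ t, v t ω = α + γ * (ε (t - 1) ω - δ) ^ 2 + β * v (t - 1) ω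
  stationary : IsStrictlyStationary v P

/-- The stability coefficient `λ = E log |β - γ ε₀ σ₀⁻² (ε₀ - δ)|` of VGARCH, where `e = ε₀` and
`v₀ = σ₀²` is the squared volatility of the stationary solution at time `0`. -/
noncomputable def vgarchStabilityCoeff {Ω : Type*} [MeasurableSpace Ω] (P : Measure Ω)
    (e v₀ : Ω → ℝ) (β γ δ : ℝ) : ℝ :=
  ∫ ω, Real.log |β - γ * e ω * (v₀ ω)⁻¹ * (e ω - δ)| ∂P

/-- The VGARCH volatility map `H(θ, y, x) = α + β x + γ (y x^{-1/2} - δ)²`, for `x > 0`. -/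
noncomputable def vgarchH (α β γ δ y x : ℝ) : ℝ :=
  α + β * x + γ * (y / √x - δ) ^ 2

/-- The process `(v, w) = (σ², σ̂²)` is a solution, driven by `e`, of the system
`σ_t² = H(θ, σ_{t-1} e_{t-1}, σ_{t-1}²)`, `σ̂_t² = H(θ, σ_{t-1} e_{t-1}, σ̂_{t-1}²)`, `t ≥ 1`:
both components are random, positive, start from values independent of the innovations
`e_0, e_1, …`, and satisfy the two equations. -/
structure IsVGARCHSystemSolution {Ω : Type*} [MeasurableSpace Ω] (P : Measure Ω)
    (e : ℕ → Ω → ℝ) (α β γ δ : ℝ) (v w : ℕ → Ω → ℝ) : Prop where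
  measurable_fst : ∀ t, Measurable (v t)
  measurable_snd : ∀ t, Measurable (w t)
  pos : ∀ᵐ ω ∂P, ∀ t, 0 < v t ω ∧ 0 < w t ω
  evolution_fst : ∀ᵐ ω ∂P, ∀ t,
    v (t + 1) ω = vgarchH α β γ δ (√(v t ω) * e t ω) (v t ω)
  evolution_snd : ∀ᵐ ω ∂P, ∀ t,
    w (t + 1) ω = vgarchH α β γ δ (√(v t ω) * e t ω) (w t ω)
  indep_initial : IndepFun (fun ω => (v 0 ω, w 0 ω)) (fun ω t => e t ω) P

/-! The pair `(v, w)` of squared volatilities is a Markov chain driven by the innovations. Its first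
coordinate evolves autonomously and the diagonal is absorbing. The aim is an invariant law of this
chain with first marginal the stationary law `μ` and no mass on the diagonal.

The gap `w - v` evolves multiplicatively. One step multiplies it by `β (1 + B e - A e²)`, with `A`,
`B` bounded continuous functions of the state (`pairStep_gap`). The quadratic has real roots, so its
expected log-modulus is a sum of terms `E log |1 - s e|`. The bound on `|x| g x` makes such a term
continuous in `s`, and bounded for bounded `s` (`continuous_integral_log_affine`,
`integral_abs_log_affine_le`). Hence the expected log-growth `drift` is a bounded continuous
function on the plane, and its mean along the diagonal under `μ` is the stability coefficient
(`stabilityCoeff_eq_integral_drift`).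

Start the chain from `(v, v + 1)` with `v` of law `μ`. The mean of `log |w - v|` starts at `0`,
increases at each step by the mean drift, and stays bounded above because first moments stay bounded
(`IsAdmissible.push`). The Cesàro averages of the drift therefore have a nonpositive limit, and a
limit point of the averaged laws is an invariant law with nonpositive mean drift
(`exists_invariant_drift_nonpos`). If it lived on the diagonal, its mean drift would be the
stability coefficient, which is positive. So it charges the complement of the diagonal. Conditioning
on that complement keeps it invariant, since no mass can enter the complement from the diagonal
(`push_cond_off_diag`). The first marginal remains `μ` because the stationary law is unique
(`eq_of_volPush_eq`).

Finally `w 0` is sampled from the conditional law given `v 0` on an extra coordinate. As `v 0` is a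
function of past innovations, the pair is independent of the future ones
(`map_compProd_condKernel`), and invariance of the law becomes stationarity of the trajectory. -/

namespace VGARCH

open Filter Topology Set

/-! ### Logarithmic moments of affine functions of a random variable -/

/-- `ρ` has a Lebesgue density `g` with `|x| g x ≤ M`. -/
def TailBoundedDensity (ρ : Measure ℝ) (M : ℝ) : Prop :=
  ∃ g : ℝ → ℝ, Measurable g ∧ (∀ x, |x| * g x ≤ M) ∧
    ρ = volume.withDensity fun x => ENNReal.ofReal (g x)

/-- The logarithm of `|z|`, truncated from below at `log η`. -/
noncomputable def truncLog (η z : ℝ) : ℝ := Real.log (max |z| η)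

lemma continuous_truncLog {η : ℝ} (hη : 0 < η) : Continuous (truncLog η) := by
  unfold truncLog
  refine Continuous.log (by fun_prop) fun z => ?_
  exact (lt_max_of_lt_right hη).ne'

lemma abs_truncLog_le {η : ℝ} (hη : 0 < η) (hη1 : η ≤ 1) (y : ℝ) :
    |truncLog η (1 - y)| ≤ |y| + |Real.log η| := by
  have h0 : 0 < max |1 - y| η := lt_max_of_lt_right hη
  have h1 : max |1 - y| η ≤ 1 + |y| :=
    max_le ((abs_sub _ _).trans (by simp)) (by linarith [abs_nonneg y])
  have hup : truncLog η (1 - y) ≤ |y| := by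
    have := Real.log_le_sub_one_of_pos h0
    unfold truncLog; linarith
  have hlow : Real.log η ≤ truncLog η (1 - y) := Real.log_le_log hη (le_max_right _ _)
  rw [abs_le]
  constructor <;> linarith [neg_abs_le (Real.log η), abs_nonneg (Real.log η), abs_nonneg y]

lemma truncLog_eq_of_le {η z : ℝ} (h : η ≤ |z|) : truncLog η z = Real.log z := by
  simp [truncLog, max_eq_left h]

lemma log_le_truncLog {η z : ℝ} (hz : z ≠ 0) :
    Real.log z ≤ truncLog η z := by
  rw [← Real.log_abs]
  exact Real.log_le_log (abs_pos.2 hz) (le_max_left _ _)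

/-- The integrand vanishes for `|z| ≥ η`, and `log η - log |z|` integrates to exactly `2η` over
`(-η, η]`. -/
lemma lintegral_truncLog_sub_log {η : ℝ} (hη : 0 < η) :
    ∫⁻ z, ENNReal.ofReal (truncLog η z - Real.log z) ≤ ENNReal.ofReal (2 * η) := by
  have hsupp : (fun z => ENNReal.ofReal (truncLog η z - Real.log z)) =
      (Ioc (-η) η).indicator fun z => ENNReal.ofReal (truncLog η z - Real.log z) := by
    ext z
    by_cases hz : z ∈ Ioc (-η) η
    · simp [hz]
    · have : η ≤ |z| := by
        simp only [mem_Ioc, not_and_or, not_lt, not_le] at hz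
        rcases hz with h | h
        · rw [le_abs]; right; linarith
        · rw [le_abs]; left; linarith
      simp [hz, truncLog_eq_of_le this]
  have hint : IntervalIntegrable (fun z => Real.log η - Real.log z) volume (-η) η :=
    intervalIntegrable_const.sub intervalIntegral.intervalIntegrable_log'
  rw [hsupp, lintegral_indicator measurableSet_Ioc]
  have hval : ∫ z in (-η)..η, (Real.log η - Real.log z) = 2 * η := by
    rw [intervalIntegral.integral_sub intervalIntegrable_const
      intervalIntegral.intervalIntegrable_log', integral_log]
    simp [Real.log_neg_eq_log]; ring
  rw [intervalIntegral.integral_of_le (by linarith)] at hval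
  have hnn : ∀ᵐ z ∂(volume.restrict (Ioc (-η) η)), 0 ≤ Real.log η - Real.log z := by
    have hne : ∀ᵐ z : ℝ ∂(volume.restrict (Ioc (-η) η)), z ≠ 0 :=
      ae_restrict_of_ae (Measure.ae_ne volume 0)
    filter_upwards [ae_restrict_mem measurableSet_Ioc, hne] with z hz h0
    rw [← Real.log_abs z]
    linarith [Real.log_le_log (abs_pos.2 h0) (abs_le.2 ⟨hz.1.le, hz.2⟩)]
  rw [← hval, ofReal_integral_eq_lintegral_ofReal
    ((intervalIntegrable_iff_integrableOn_Ioc_of_le (by linarith)).1 hint) hnn]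
  refine lintegral_mono_ae ?_
  filter_upwards [ae_restrict_mem measurableSet_Ioc] with z hz
  have : |z| ≤ η := abs_le.2 ⟨hz.1.le, hz.2⟩
  simp [truncLog, max_eq_right this]

lemma measurable_truncLog_sub_log {η : ℝ} (hη : 0 < η) :
    Measurable fun z => truncLog η z - Real.log z :=
  (continuous_truncLog hη).measurable.sub Real.measurable_log

lemma lintegral_comp_one_sub_mul {F : ℝ → ENNReal} (hF : Measurable F) {s : ℝ} (hs : s ≠ 0) :
    ∫⁻ x, F (1 - s * x) = ENNReal.ofReal |s⁻¹| * ∫⁻ z, F z := by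
  have h1 : ∫⁻ y, F (1 - y) ∂(Measure.map (fun x => s * x) volume) = ∫⁻ x, F (1 - s * x) :=
    lintegral_map (hF.comp (by fun_prop)) (by fun_prop)
  rw [← h1, Real.map_volume_mul_left hs, lintegral_smul_measure, smul_eq_mul,
    lintegral_sub_left_eq_self]

/-- The point is uniformity in `s`. Truncation matters only where `|1 - s x| < η ≤ 1/2`. There `|s
x| ≥ 1/2`, so `|x| g x ≤ M` gives `g x ≤ 2 M |s|`, and the factor `|s|` cancels the Jacobian of `z =
1 - s x`. -/
lemma lintegral_truncLog_sub_log_affine {ρ : Measure ℝ} {M : ℝ} (hM : 0 ≤ M)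
    (hρ : TailBoundedDensity ρ M) (s : ℝ) {η : ℝ} (hη : 0 < η) (hη1 : η ≤ 1 / 2) :
    ∫⁻ x, ENNReal.ofReal (truncLog η (1 - s * x) - Real.log (1 - s * x)) ∂ρ ≤
      ENNReal.ofReal (4 * M * η) := by
  obtain ⟨g, hg, hgM, rfl⟩ := hρ
  rcases eq_or_ne s 0 with rfl | hs
  · have : truncLog η 1 = Real.log 1 := truncLog_eq_of_le (by simp; linarith)
    simp [this]
  set F : ℝ → ENNReal := fun z => ENNReal.ofReal (truncLog η z - Real.log z) with hFdef
  have hF : Measurable F := (measurable_truncLog_sub_log hη).ennreal_ofReal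
  change ∫⁻ x, F (1 - s * x) ∂_ ≤ _
  have hFs : Measurable fun x => F (1 - s * x) := hF.comp (by fun_prop)
  rw [lintegral_withDensity_eq_lintegral_mul _ hg.ennreal_ofReal hFs]
  have hpt : ∀ x, ((fun x => ENNReal.ofReal (g x)) * fun x => F (1 - s * x)) x ≤
      ENNReal.ofReal (2 * M * |s|) * F (1 - s * x) := by
    intro x
    by_cases hx : η ≤ |1 - s * x|
    · simp [hFdef, truncLog_eq_of_le hx]
    · push Not at hx
      simp only [Pi.mul_apply]
      gcongr
      have h1 : 1 / 2 ≤ |s| * |x| := by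
        rw [← abs_mul]
        have := abs_sub_abs_le_abs_sub 1 (s * x)
        simp only [abs_one] at this
        linarith
      by_cases hg0 : g x ≤ 0
      · exact hg0.trans (by positivity)
      · push Not at hg0
        nlinarith [mul_le_mul_of_nonneg_left (hgM x) (abs_nonneg s),
          mul_le_mul_of_nonneg_right h1 hg0.le]
  refine (lintegral_mono hpt).trans ?_
  rw [lintegral_const_mul _ hFs, lintegral_comp_one_sub_mul hF hs]
  calc _ ≤ ENNReal.ofReal (2 * M * |s|) * (ENNReal.ofReal |s⁻¹| * ENNReal.ofReal (2 * η)) := by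
        gcongr
        exact lintegral_truncLog_sub_log hη
    _ = ENNReal.ofReal (4 * M * η) := by
        rw [← ENNReal.ofReal_mul (abs_nonneg _), ← ENNReal.ofReal_mul (by positivity), abs_inv]
        congr 1
        have := abs_ne_zero.2 hs
        field_simp
        ring

lemma ae_one_sub_mul_ne_zero {ρ : Measure ℝ} {M : ℝ} (hρ : TailBoundedDensity ρ M) (s : ℝ) :
    ∀ᵐ x ∂ρ, 1 - s * x ≠ 0 := by
  obtain ⟨g, hg, hgM, rfl⟩ := hρ
  refine (withDensity_absolutelyContinuous _ _).ae_le ?_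
  filter_upwards [Measure.ae_ne volume s⁻¹] with x hx h
  have hs : s * x = 1 := by linarith
  exact hx (eq_inv_of_mul_eq_one_right hs)

lemma integrable_truncLog_sub_log {ρ : Measure ℝ} {M : ℝ} (hM : 0 ≤ M)
    (hρ : TailBoundedDensity ρ M) (s : ℝ) {η : ℝ} (hη : 0 < η) (hη1 : η ≤ 1 / 2) :
    Integrable (fun x => truncLog η (1 - s * x) - Real.log (1 - s * x)) ρ := by
  refine ⟨((measurable_truncLog_sub_log hη).comp (by fun_prop :
    Measurable fun x => 1 - s * x)).aestronglyMeasurable, ?_⟩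
  rw [hasFiniteIntegral_iff_ofReal]
  · exact (lintegral_truncLog_sub_log_affine hM hρ s hη hη1).trans_lt ENNReal.ofReal_lt_top
  · filter_upwards [ae_one_sub_mul_ne_zero hρ s] with x hx
    exact sub_nonneg.2 (log_le_truncLog hx)

lemma integral_truncLog_sub_log_mem {ρ : Measure ℝ} {M : ℝ} (hM : 0 ≤ M)
    (hρ : TailBoundedDensity ρ M) (s : ℝ) {η : ℝ} (hη : 0 < η) (hη1 : η ≤ 1 / 2) :
    ∫ x, (truncLog η (1 - s * x) - Real.log (1 - s * x)) ∂ρ ∈ Icc 0 (4 * M * η) := by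
  have hnn : ∀ᵐ x ∂ρ, 0 ≤ truncLog η (1 - s * x) - Real.log (1 - s * x) := by
    filter_upwards [ae_one_sub_mul_ne_zero hρ s] with x hx
    exact sub_nonneg.2 (log_le_truncLog hx)
  refine ⟨integral_nonneg_of_ae hnn, ?_⟩
  rw [integral_eq_lintegral_of_nonneg_ae hnn
    (integrable_truncLog_sub_log hM hρ s hη hη1).aestronglyMeasurable]
  exact ENNReal.toReal_le_of_le_ofReal (by positivity)
    (lintegral_truncLog_sub_log_affine hM hρ s hη hη1)

section LogMoment

variable {ρ : Measure ℝ} [IsProbabilityMeasure ρ] {M : ℝ}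

lemma integrable_truncLog (hid : Integrable (fun x => x) ρ) (s : ℝ) {η : ℝ} (hη : 0 < η)
    (hη1 : η ≤ 1 / 2) : Integrable (fun x => truncLog η (1 - s * x)) ρ := by
  refine Integrable.mono' ((hid.abs.const_mul |s|).add (integrable_const |Real.log η|))
    ((continuous_truncLog hη).comp (by fun_prop)).aestronglyMeasurable (ae_of_all _ fun x => ?_)
  have := abs_truncLog_le hη (by linarith) (s * x)
  rwa [abs_mul] at this

lemma integrable_log_affine (hM : 0 ≤ M) (hρ : TailBoundedDensity ρ M)
    (hid : Integrable (fun x => x) ρ) (s : ℝ) :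
    Integrable (fun x => Real.log (1 - s * x)) ρ := by
  have h := (integrable_truncLog hid s (η := 1 / 2) (by norm_num) le_rfl).sub
    (integrable_truncLog_sub_log hM hρ s (η := 1 / 2) (by norm_num) le_rfl)
  refine h.congr (ae_of_all _ fun x => ?_)
  simp

/-- Large values of the logarithm are controlled by the first moment, small ones by the truncation
error at `η = 1/2`. This is what makes the drift bounded. -/
lemma integral_abs_log_affine_le (hM : 0 ≤ M) (hρ : TailBoundedDensity ρ M)
    (hid : Integrable (fun x => x) ρ) {s C : ℝ} (hs : |s| ≤ C) :
    ∫ x, |Real.log (1 - s * x)| ∂ρ ≤ C * (∫ x, |x| ∂ρ) + |Real.log (1 / 2)| + 2 * M := by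
  have hD := integrable_truncLog_sub_log hM hρ s (η := 1 / 2) (by norm_num) le_rfl
  have hmem := (integral_truncLog_sub_log_mem hM hρ s (η := 1 / 2) (by norm_num) le_rfl).2
  have hE : Integrable (fun x => C * |x| + |Real.log (1 / 2)|) ρ :=
    (hid.abs.const_mul C).add (integrable_const _)
  have hbd : ∫ x, |Real.log (1 - s * x)| ∂ρ ≤ ∫ x, ((C * |x| + |Real.log (1 / 2)|) +
      (truncLog (1 / 2) (1 - s * x) - Real.log (1 - s * x))) ∂ρ := by
    refine integral_mono_ae (integrable_log_affine hM hρ hid s).abs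
      (hE.add hD) ?_
    filter_upwards [ae_one_sub_mul_ne_zero hρ s] with x hx
    have h1 := abs_truncLog_le (η := 1 / 2) (by norm_num) (by norm_num) (s * x)
    have h2 := log_le_truncLog (η := 1 / 2) hx
    have h3 : |s * x| ≤ C * |x| := by rw [abs_mul]; gcongr
    have h4 := abs_le.1 h1
    rw [abs_le]
    constructor <;> linarith
  rw [integral_add hE hD,
    integral_add (hid.abs.const_mul C) (integrable_const _), integral_const_mul] at hbd
  simp at hbd hmem ⊢
  linarith

/-- The logarithmic moment `E log |1 - s e|` is a continuous function of `s`. -/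
lemma continuous_integral_log_affine (hM : 0 ≤ M) (hρ : TailBoundedDensity ρ M)
    (hid : Integrable (fun x => x) ρ) :
    Continuous fun s : ℝ => ∫ x, Real.log (1 - s * x) ∂ρ := by
  -- Truncated moments are continuous by dominated convergence. They approximate the true ones
  -- within `4 M η` uniformly in `s`, so continuity passes to the limit.
  have htr : ∀ η : ℝ, 0 < η → η ≤ 1 / 2 →
      Continuous fun s : ℝ => ∫ x, truncLog η (1 - s * x) ∂ρ := by
    intro η hη hη1
    rw [continuous_iff_continuousAt]
    intro s₀
    refine continuousAt_of_dominated (bound := fun x => (|s₀| + 1) * |x| + |Real.log η|)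
      (Eventually.of_forall fun s =>
        ((continuous_truncLog hη).comp (by fun_prop)).aestronglyMeasurable) ?_
      ((hid.abs.const_mul _).add (integrable_const _)) (ae_of_all _ fun x => ?_)
    · filter_upwards [Metric.ball_mem_nhds s₀ one_pos] with s hs
      refine ae_of_all _ fun x => ?_
      have h1 := abs_truncLog_le hη (by linarith) (s * x)
      have h2 : |s| ≤ |s₀| + 1 := by
        rw [Metric.mem_ball, Real.dist_eq] at hs
        linarith [abs_sub_abs_le_abs_sub s s₀]
      rw [abs_mul] at h1
      rw [Real.norm_eq_abs]
      nlinarith [mul_le_mul_of_nonneg_right h2 (abs_nonneg x)]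
    · exact ((continuous_truncLog hη).comp (by fun_prop)).continuousAt
  refine Metric.continuous_iff.2 fun s₀ ε hε => ?_
  obtain ⟨η, hη, hη1, hηε⟩ : ∃ η : ℝ, 0 < η ∧ η ≤ 1 / 2 ∧ 4 * M * η < ε / 2 := by
    refine ⟨min (1 / 2) (ε / (8 * M + 8)), by positivity, min_le_left _ _, ?_⟩
    calc 4 * M * min (1 / 2) (ε / (8 * M + 8)) ≤ 4 * M * (ε / (8 * M + 8)) := by
          gcongr; exact min_le_right _ _
      _ < ε / 2 := by
          rw [mul_div_assoc', div_lt_div_iff₀ (by positivity) (by positivity)]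
          nlinarith
  obtain ⟨r, hr, hr'⟩ := Metric.continuous_iff.1 (htr η hη hη1) s₀ (ε / 2) (by positivity)
  refine ⟨r, hr, fun s hs => ?_⟩
  have key : ∀ t : ℝ, ∫ x, truncLog η (1 - t * x) ∂ρ - ∫ x, Real.log (1 - t * x) ∂ρ ∈
      Icc 0 (4 * M * η) := by
    intro t
    rw [← integral_sub (integrable_truncLog hid t hη hη1) (integrable_log_affine hM hρ hid t)]
    exact integral_truncLog_sub_log_mem hM hρ t hη hη1
  have h1 := key s
  have h2 := key s₀
  have h3 := hr' s hs
  rw [Real.dist_eq, abs_lt] at h3 ⊢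
  constructor <;> linarith [h1.1, h1.2, h2.1, h2.2, h3.1, h3.2]

end LogMoment

/-! ### The two-point motion -/

/-- One step of the squared volatility. -/
def volStep (α β γ δ v e : ℝ) : ℝ := α + γ * (e - δ) ^ 2 + β * v

/-- One step of the two-point motion, continuously extended from `[α, ∞)²` to the plane. -/
noncomputable def pairStep (α β γ δ : ℝ) (x : ℝ × ℝ) (e : ℝ) : ℝ × ℝ :=
  (volStep α β γ δ x.1 e,
    α + β * x.2 + γ * (√x.1 * e / √(max x.2 α) - δ) ^ 2)

/-- The set `[α, ∞)²`, which the two-point motion does not leave. -/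
def quadrant (α : ℝ) : Set (ℝ × ℝ) := {x | α ≤ x.1 ∧ α ≤ x.2}

section Step

variable {α β γ δ : ℝ}

lemma vgarchH_self {v : ℝ} (hv : 0 < v) (e : ℝ) :
    vgarchH α β γ δ (√v * e) v = volStep α β γ δ v e := by
  have := (Real.sqrt_pos.2 hv).ne'
  unfold vgarchH volStep
  rw [mul_div_cancel_left₀ _ this]
  ring

lemma pairStep_snd {x : ℝ × ℝ} (hx : α ≤ x.2) (e : ℝ) :
    (pairStep α β γ δ x e).2 = vgarchH α β γ δ (√x.1 * e) x.2 := by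
  simp [pairStep, vgarchH, max_eq_left hx]

lemma continuous_volStep : Continuous fun p : ℝ × ℝ => volStep α β γ δ p.1 p.2 := by
  unfold volStep; fun_prop

lemma continuous_pairStep (hα : 0 < α) :
    Continuous fun p : (ℝ × ℝ) × ℝ => pairStep α β γ δ p.1 p.2 := by
  have hne : ∀ p : (ℝ × ℝ) × ℝ, √(max p.1.2 α) ≠ 0 := fun p =>
    (Real.sqrt_pos.2 (lt_max_of_lt_right hα)).ne'
  refine Continuous.prodMk (continuous_volStep.comp (by fun_prop :
    Continuous fun p : (ℝ × ℝ) × ℝ => (p.1.1, p.2))) ?_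
  have h1 : Continuous fun p : (ℝ × ℝ) × ℝ => √p.1.1 * p.2 / √(max p.1.2 α) :=
    Continuous.div (by fun_prop) (by fun_prop) hne
  fun_prop

lemma pairStep_mem_quadrant (hα : 0 < α) (hβ : 0 < β) (hγ : 0 ≤ γ) {x : ℝ × ℝ}
    (hx : x ∈ quadrant α) (e : ℝ) : pairStep α β γ δ x e ∈ quadrant α := by
  have h1 : 0 ≤ β * x.1 := mul_nonneg hβ.le (hα.le.trans hx.1)
  have h2 : 0 ≤ β * x.2 := mul_nonneg hβ.le (hα.le.trans hx.2)
  constructor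
  · have := mul_nonneg hγ (sq_nonneg (e - δ))
    simp only [pairStep, volStep]; linarith
  · have := mul_nonneg hγ (sq_nonneg (√x.1 * e / √(max x.2 α) - δ))
    simp only [pairStep]; linarith

/-- Absorption at the diagonal: with equal volatilities, both coordinates apply the same map to the
same return. -/
lemma pairStep_diag {x : ℝ × ℝ} (hα : 0 < α) (hx : x ∈ quadrant α) (hd : x.1 = x.2) (e : ℝ) :
    (pairStep α β γ δ x e).1 = (pairStep α β γ δ x e).2 := by
  rw [pairStep_snd hx.2, ← hd, vgarchH_self (hα.trans_le hx.1)]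
  rfl

/-- A bound for the growth of the second coordinate, free of cross terms. -/
lemma pairStep_snd_le (hα : 0 < α) (hγ : 0 ≤ γ) {x : ℝ × ℝ} (hx : x ∈ quadrant α) (e : ℝ) :
    (pairStep α β γ δ x e).2 ≤ (α + 2 * γ * δ ^ 2) + β * x.2 + 2 * γ / α * (x.1 * e ^ 2) := by
  have hx2 : 0 < x.2 := hα.trans_le hx.2
  have hx1 : 0 < x.1 := hα.trans_le hx.1
  have h1 : (√x.1 * e / √x.2) ^ 2 ≤ x.1 * e ^ 2 / α := by
    rw [div_pow, mul_pow, Real.sq_sqrt hx1.le, Real.sq_sqrt hx2.le]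
    gcongr
    exact hx.2
  have h2 : (√x.1 * e / √x.2 - δ) ^ 2 ≤ 2 * (x.1 * e ^ 2 / α) + 2 * δ ^ 2 := by
    nlinarith [sq_nonneg (√x.1 * e / √x.2 + δ)]
  have h3 := mul_le_mul_of_nonneg_left h2 hγ
  simp only [pairStep, max_eq_left hx.2]
  calc _ ≤ α + β * x.2 + γ * (2 * (x.1 * e ^ 2 / α) + 2 * δ ^ 2) := by linarith
    _ = _ := by ring

end Step

/-! ### The multiplicative growth of the gap -/

/-- The quadratic coefficient of the relative growth of the gap. -/
noncomputable def quadCoef (α β γ : ℝ) (x : ℝ × ℝ) : ℝ := γ / (β * max x.2 α)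

/-- The linear coefficient of the relative growth of the gap. -/
noncomputable def linCoef (α β γ δ : ℝ) (x : ℝ × ℝ) : ℝ :=
  2 * δ * γ / (β * (√(max x.2 α) * (√(max x.2 α) + √x.1)))

/-- The inverse roots of `1 + B e - A e²`, where `A`, `B` are the coefficients above. -/
noncomputable def invRoot (α β γ δ σ : ℝ) (x : ℝ × ℝ) : ℝ :=
  (-linCoef α β γ δ x + σ * √(linCoef α β γ δ x ^ 2 + 4 * quadCoef α β γ x)) / 2

section Gap

variable {α β γ δ : ℝ}

lemma quadCoef_nonneg (hα : 0 < α) (hβ : 0 < β) (hγ : 0 ≤ γ) (x : ℝ × ℝ) :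
    0 ≤ quadCoef α β γ x :=
  div_nonneg hγ (mul_nonneg hβ.le (hα.le.trans (le_max_right _ _)))

lemma quadCoef_le (hα : 0 < α) (hβ : 0 < β) (hγ : 0 ≤ γ) (x : ℝ × ℝ) :
    quadCoef α β γ x ≤ γ / (β * α) := by
  unfold quadCoef
  gcongr
  exact le_max_right _ _

lemma abs_linCoef_le (hα : 0 < α) (hβ : 0 < β) (x : ℝ × ℝ) :
    |linCoef α β γ δ x| ≤ |2 * δ * γ| / (β * α) := by
  have hm : α ≤ max x.2 α := le_max_right _ _
  have h1 : α ≤ √(max x.2 α) * (√(max x.2 α) + √x.1) := by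
    rw [mul_add, Real.mul_self_sqrt (hα.le.trans hm)]
    linarith [mul_nonneg (Real.sqrt_nonneg (max x.2 α)) (Real.sqrt_nonneg x.1)]
  unfold linCoef
  rw [abs_div, abs_of_pos (mul_pos hβ (hα.trans_le h1))]
  gcongr

lemma continuous_invRoot (hα : 0 < α) (hβ : 0 < β) (σ : ℝ) :
    Continuous (invRoot α β γ δ σ) := by
  have hs : ∀ x : ℝ × ℝ, 0 < √(max x.2 α) := fun x =>
    Real.sqrt_pos.2 (lt_max_of_lt_right hα)
  have h1 : Continuous (quadCoef α β γ) :=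
    Continuous.div (by fun_prop) (by fun_prop) fun x =>
      (mul_pos hβ (lt_max_of_lt_right hα)).ne'
  have h2 : Continuous (linCoef α β γ δ) :=
    Continuous.div (by fun_prop) (by fun_prop) fun x =>
      (mul_pos hβ (mul_pos (hs x) (add_pos_of_pos_of_nonneg (hs x) (Real.sqrt_nonneg _)))).ne'
  unfold invRoot
  fun_prop

lemma abs_invRoot_le (hα : 0 < α) (hβ : 0 < β) (hγ : 0 ≤ γ) {σ : ℝ} (hσ : |σ| = 1)
    (x : ℝ × ℝ) : |invRoot α β γ δ σ x| ≤
      |2 * δ * γ| / (β * α) + √((|2 * δ * γ| / (β * α)) ^ 2 + 4 * (γ / (β * α))) := by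
  have h1 := abs_linCoef_le (γ := γ) (δ := δ) hα hβ x
  have h2 := quadCoef_le hα hβ hγ x
  have h3 : √(linCoef α β γ δ x ^ 2 + 4 * quadCoef α β γ x) ≤
      √((|2 * δ * γ| / (β * α)) ^ 2 + 4 * (γ / (β * α))) := by
    refine Real.sqrt_le_sqrt (add_le_add ?_ (by linarith))
    exact sq_le_sq' (by linarith [neg_abs_le (linCoef α β γ δ x)]) ((le_abs_self _).trans h1)
  unfold invRoot
  rw [abs_div, abs_two, div_le_iff₀ two_pos]
  refine (abs_add_le _ _).trans ?_
  rw [abs_neg, abs_mul, hσ, one_mul, abs_of_nonneg (Real.sqrt_nonneg _)]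
  have := abs_nonneg (linCoef α β γ δ x)
  have := Real.sqrt_nonneg (linCoef α β γ δ x ^ 2 + 4 * quadCoef α β γ x)
  linarith

/-- The discriminant is nonnegative since `A ≥ 0`, so the factorization is real. Inverse roots,
unlike roots, stay bounded and continuous when `A` or `B` vanishes. -/
lemma mul_invRoots (hα : 0 < α) (hβ : 0 < β) (hγ : 0 ≤ γ) (x : ℝ × ℝ) (e : ℝ) :
    (1 - invRoot α β γ δ 1 x * e) * (1 - invRoot α β γ δ (-1) x * e) =
      1 + linCoef α β γ δ x * e - quadCoef α β γ x * e ^ 2 := by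
  have h := Real.sq_sqrt (add_nonneg (sq_nonneg (linCoef α β γ δ x))
    (mul_nonneg (by norm_num : (0 : ℝ) ≤ 4) (quadCoef_nonneg hα hβ hγ x)))
  unfold invRoot
  linear_combination (-e ^ 2 / 4) * h

/-- Expand both squares and use `√w - √v = (w - v) / (√w + √v)` in the term linear in `e`; then `w -
v` factors out. -/
lemma pairStep_gap (hα : 0 < α) (hβ : 0 < β) (hγ : 0 ≤ γ) {x : ℝ × ℝ} (hx : x ∈ quadrant α)
    (e : ℝ) : (pairStep α β γ δ x e).2 - (pairStep α β γ δ x e).1 =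
      (x.2 - x.1) * (β * ((1 - invRoot α β γ δ 1 x * e) * (1 - invRoot α β γ δ (-1) x * e))) := by
  rw [mul_invRoots hα hβ hγ]
  obtain ⟨v, w⟩ := x
  have hv : 0 < v := hα.trans_le hx.1
  have hw : 0 < w := hα.trans_le hx.2
  have hw' : max w α = w := max_eq_left hx.2
  simp only [pairStep, volStep, quadCoef, linCoef, hw']
  have hsv := Real.sqrt_pos.2 hv
  have hsw := Real.sqrt_pos.2 hw
  -- In terms of the square roots the claim is an identity of rational functions.
  have h1 : v = √v ^ 2 := (Real.sq_sqrt hv.le).symm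
  have h2 : w = √w ^ 2 := (Real.sq_sqrt hw.le).symm
  generalize √v = a at *
  generalize √w = b at *
  subst h1 h2
  have : b + a ≠ 0 := by positivity
  field_simp
  ring

/-- On the diagonal, the relative growth of the gap is the derivative of the volatility map. -/
lemma diag_growth (hα : 0 < α) (hβ : 0 < β) (hγ : 0 ≤ γ) {v : ℝ} (hv : α ≤ v) (e : ℝ) :
    β * ((1 - invRoot α β γ δ 1 (v, v) * e) * (1 - invRoot α β γ δ (-1) (v, v) * e)) =
      β - γ * e * v⁻¹ * (e - δ) := by
  rw [mul_invRoots hα hβ hγ]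
  have hv0 : 0 < v := hα.trans_le hv
  have hsv := Real.sqrt_pos.2 hv0
  have h1 : v = √v ^ 2 := (Real.sq_sqrt hv0.le).symm
  simp only [quadCoef, linCoef, max_eq_left hv]
  generalize √v = a at *
  subst h1
  field_simp
  ring

/-- The expected logarithmic growth of the gap. -/
noncomputable def drift (ρ : Measure ℝ) (α β γ δ : ℝ) (x : ℝ × ℝ) : ℝ :=
  Real.log β + ∫ e, Real.log (1 - invRoot α β γ δ 1 x * e) ∂ρ +
    ∫ e, Real.log (1 - invRoot α β γ δ (-1) x * e) ∂ρ

end Gap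

section Drift

variable {ρ : Measure ℝ} [IsProbabilityMeasure ρ] {M α β γ δ : ℝ}

lemma continuous_drift (hM : 0 ≤ M) (hρ : TailBoundedDensity ρ M)
    (hid : Integrable (fun x => x) ρ) (hα : 0 < α) (hβ : 0 < β) :
    Continuous (drift ρ α β γ δ) := by
  have h := continuous_integral_log_affine hM hρ hid
  exact (continuous_const.add (h.comp (continuous_invRoot hα hβ 1))).add
    (h.comp (continuous_invRoot hα hβ (-1)))

lemma exists_integral_abs_log_le (hM : 0 ≤ M) (hρ : TailBoundedDensity ρ M)
    (hid : Integrable (fun x => x) ρ) (hα : 0 < α) (hβ : 0 < β) (hγ : 0 ≤ γ) :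
    ∃ C, ∀ σ : ℝ, |σ| = 1 → ∀ x,
      ∫ e, |Real.log (1 - invRoot α β γ δ σ x * e)| ∂ρ ≤ C :=
  ⟨_, fun _ hσ x => integral_abs_log_affine_le hM hρ hid (abs_invRoot_le hα hβ hγ hσ x)⟩

lemma exists_abs_drift_le (hM : 0 ≤ M) (hρ : TailBoundedDensity ρ M)
    (hid : Integrable (fun x => x) ρ) (hα : 0 < α) (hβ : 0 < β) (hγ : 0 ≤ γ) :
    ∃ C, ∀ x, |drift ρ α β γ δ x| ≤ C := by
  obtain ⟨C, hC⟩ := exists_integral_abs_log_le (δ := δ) hM hρ hid hα hβ hγ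
  refine ⟨|Real.log β| + C + C, fun x => ?_⟩
  refine (abs_add_le _ _).trans (add_le_add ((abs_add_le _ _).trans (add_le_add le_rfl ?_)) ?_)
  · exact abs_integral_le_integral_abs.trans (hC 1 (by simp) x)
  · exact abs_integral_le_integral_abs.trans (hC (-1) (by simp) x)

lemma ae_prod_ne_zero {m : Measure (ℝ × ℝ)} (hρ : TailBoundedDensity ρ M)
    (hα : 0 < α) (hβ : 0 < β) (σ : ℝ) :
    ∀ᵐ p ∂(m.prod ρ), 1 - invRoot α β γ δ σ p.1 * p.2 ≠ 0 := by
  have hc : Continuous fun p : (ℝ × ℝ) × ℝ => 1 - invRoot α β γ δ σ p.1 * p.2 := by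
    have := continuous_invRoot (γ := γ) (δ := δ) hα hβ σ
    fun_prop
  have hmeas : MeasurableSet {p : (ℝ × ℝ) × ℝ | 1 - invRoot α β γ δ σ p.1 * p.2 ≠ 0} :=
    (measurableSet_eq_fun hc.measurable measurable_const).compl
  exact (Measure.ae_prod_iff_ae_ae hmeas).2
    (ae_of_all _ fun x => ae_one_sub_mul_ne_zero hρ (invRoot α β γ δ σ x))

variable {m : Measure (ℝ × ℝ)} [IsProbabilityMeasure m]

/-- The fibrewise `L¹` norms are bounded uniformly in the state, so no moment of `m` is required. -/
lemma integrable_prod_log (hM : 0 ≤ M) (hρ : TailBoundedDensity ρ M)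
    (hid : Integrable (fun x => x) ρ) (hα : 0 < α) (hβ : 0 < β) (hγ : 0 ≤ γ)
    {σ : ℝ} (hσ : |σ| = 1) :
    Integrable (fun p : (ℝ × ℝ) × ℝ => Real.log (1 - invRoot α β γ δ σ p.1 * p.2))
      (m.prod ρ) := by
  obtain ⟨C, hC⟩ := exists_integral_abs_log_le (δ := δ) hM hρ hid hα hβ hγ
  have hc : Continuous fun p : (ℝ × ℝ) × ℝ => 1 - invRoot α β γ δ σ p.1 * p.2 := by
    have := continuous_invRoot (γ := γ) (δ := δ) hα hβ σ
    fun_prop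
  have hmeas := Real.measurable_log.comp hc.measurable
  refine (integrable_prod_iff hmeas.aestronglyMeasurable).2
    ⟨ae_of_all _ fun x => integrable_log_affine hM hρ hid (invRoot α β γ δ σ x), ?_⟩
  refine Integrable.of_bound (C := C)
    (hmeas.norm.stronglyMeasurable.integral_prod_right').aestronglyMeasurable
    (ae_of_all _ fun x => ?_)
  rw [Real.norm_of_nonneg (integral_nonneg fun _ => norm_nonneg _)]
  exact hC σ hσ x

/-- The logarithmic growth of the gap along the product measure, and its expectation. -/
lemma integral_log_growth (hM : 0 ≤ M) (hρ : TailBoundedDensity ρ M)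
    (hid : Integrable (fun x => x) ρ) (hα : 0 < α) (hβ : 0 < β) (hγ : 0 ≤ γ) :
    Integrable (fun p : (ℝ × ℝ) × ℝ => Real.log (β * ((1 - invRoot α β γ δ 1 p.1 * p.2) *
      (1 - invRoot α β γ δ (-1) p.1 * p.2)))) (m.prod ρ) ∧
    ∫ p, Real.log (β * ((1 - invRoot α β γ δ 1 p.1 * p.2) *
      (1 - invRoot α β γ δ (-1) p.1 * p.2))) ∂(m.prod ρ) = ∫ x, drift ρ α β γ δ x ∂m := by
  have h1 := integrable_prod_log (m := m) (δ := δ) hM hρ hid hα hβ hγ (σ := 1) (by simp)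
  have h2 := integrable_prod_log (m := m) (δ := δ) hM hρ hid hα hβ hγ (σ := -1) (by simp)
  have hsum : Integrable (fun p : (ℝ × ℝ) × ℝ => Real.log β +
      Real.log (1 - invRoot α β γ δ 1 p.1 * p.2)) (m.prod ρ) := (integrable_const _).add h1
  have heq : (fun p : (ℝ × ℝ) × ℝ => Real.log (β * ((1 - invRoot α β γ δ 1 p.1 * p.2) *
      (1 - invRoot α β γ δ (-1) p.1 * p.2)))) =ᵐ[m.prod ρ] fun p =>
      (Real.log β + Real.log (1 - invRoot α β γ δ 1 p.1 * p.2)) +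
        Real.log (1 - invRoot α β γ δ (-1) p.1 * p.2) := by
    filter_upwards [ae_prod_ne_zero (m := m) (γ := γ) (δ := δ) hρ hα hβ 1,
      ae_prod_ne_zero (m := m) (γ := γ) (δ := δ) hρ hα hβ (-1)] with p hp1 hp2
    rw [Real.log_mul hβ.ne' (mul_ne_zero hp1 hp2), Real.log_mul hp1 hp2, add_assoc]
  have hint := (hsum.add h2).congr heq.symm
  refine ⟨hint, ?_⟩
  rw [integral_congr_ae heq, integral_prod _ (hint.congr heq)]
  refine integral_congr_ae (ae_of_all _ fun x => ?_)
  have i1 := integrable_log_affine hM hρ hid (invRoot α β γ δ 1 x)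
  have i2 := integrable_log_affine hM hρ hid (invRoot α β γ δ (-1) x)
  have i3 : Integrable (fun e => Real.log β + Real.log (1 - invRoot α β γ δ 1 x * e)) ρ :=
    (integrable_const _).add i1
  simp only [drift]
  rw [integral_add i3 i2, integral_add (integrable_const _) i1]
  simp

end Drift

/-! ### The transition operator -/

/-- The law of the two-point motion after one step, started from `m`. -/
noncomputable def push (ρ : Measure ℝ) (α β γ δ : ℝ) (m : Measure (ℝ × ℝ)) : Measure (ℝ × ℝ) :=
  (m.prod ρ).map fun p => pairStep α β γ δ p.1 p.2

/-- The law of the squared volatility after one step, started from `μ`. -/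
noncomputable def volPush (ρ : Measure ℝ) (α β γ δ : ℝ) (μ : Measure ℝ) : Measure ℝ :=
  (μ.prod ρ).map fun p => volStep α β γ δ p.1 p.2

section Push

variable {ρ : Measure ℝ} [IsProbabilityMeasure ρ] {M α β γ δ : ℝ}

lemma ae_push_gap {m : Measure (ℝ × ℝ)} (hρ : TailBoundedDensity ρ M) (hα : 0 < α) (hβ : 0 < β)
    (hγ : 0 ≤ γ) (hq : ∀ᵐ x ∂m, x ∈ quadrant α) (hd : ∀ᵐ x ∂m, x.2 - x.1 ≠ 0) :
    ∀ᵐ p ∂(m.prod ρ), (pairStep α β γ δ p.1 p.2).2 - (pairStep α β γ δ p.1 p.2).1 ≠ 0 := by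
  filter_upwards [Measure.quasiMeasurePreserving_fst.ae hq,
    Measure.quasiMeasurePreserving_fst.ae hd,
    ae_prod_ne_zero (m := m) (γ := γ) (δ := δ) hρ hα hβ 1,
    ae_prod_ne_zero (m := m) (γ := γ) (δ := δ) hρ hα hβ (-1)] with p hpq hpd h1 h2
  rw [pairStep_gap hα hβ hγ hpq]
  exact mul_ne_zero hpd (mul_ne_zero hβ.ne' (mul_ne_zero h1 h2))

/-- `Real.log` is the logarithm of the modulus, so the multiplicative gap recursion becomes additive
whatever the signs. Off the diagonal, neither the gap nor its growth factor vanishes almost surely.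
-/
lemma integral_push_log_gap {m : Measure (ℝ × ℝ)} [IsProbabilityMeasure m]
    (hM : 0 ≤ M) (hρ : TailBoundedDensity ρ M)
    (hid : Integrable (fun x => x) ρ) (hα : 0 < α) (hβ : 0 < β) (hγ : 0 ≤ γ)
    (hq : ∀ᵐ x ∂m, x ∈ quadrant α) (hd : ∀ᵐ x ∂m, x.2 - x.1 ≠ 0)
    (hl : Integrable (fun x : ℝ × ℝ => Real.log (x.2 - x.1)) m) :
    Integrable (fun x : ℝ × ℝ => Real.log (x.2 - x.1)) (push ρ α β γ δ m) ∧
    ∫ x, Real.log (x.2 - x.1) ∂(push ρ α β γ δ m) =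
      ∫ x, Real.log (x.2 - x.1) ∂m + ∫ x, drift ρ α β γ δ x ∂m := by
  obtain ⟨hint, hval⟩ := integral_log_growth (m := m) (δ := δ) hM hρ hid hα hβ hγ
  have hTm := (continuous_pairStep (β := β) (γ := γ) (δ := δ) hα).measurable
  have hlm : Measurable fun x : ℝ × ℝ => Real.log (x.2 - x.1) := by fun_prop
  have heq : (fun p : (ℝ × ℝ) × ℝ =>
      Real.log ((pairStep α β γ δ p.1 p.2).2 - (pairStep α β γ δ p.1 p.2).1)) =ᵐ[m.prod ρ]
      fun p => Real.log (p.1.2 - p.1.1) + Real.log (β * ((1 - invRoot α β γ δ 1 p.1 * p.2) *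
        (1 - invRoot α β γ δ (-1) p.1 * p.2))) := by
    filter_upwards [Measure.quasiMeasurePreserving_fst.ae hq,
      Measure.quasiMeasurePreserving_fst.ae hd,
      ae_prod_ne_zero (m := m) (γ := γ) (δ := δ) hρ hα hβ 1,
      ae_prod_ne_zero (m := m) (γ := γ) (δ := δ) hρ hα hβ (-1)] with p hpq hpd h1 h2
    rw [pairStep_gap hα hβ hγ hpq,
      Real.log_mul hpd (mul_ne_zero hβ.ne' (mul_ne_zero h1 h2))]
  have hl' : Integrable (fun p : (ℝ × ℝ) × ℝ => Real.log (p.1.2 - p.1.1)) (m.prod ρ) :=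
    hl.comp_fst ρ
  constructor
  · unfold push
    rw [integrable_map_measure hlm.aestronglyMeasurable hTm.aemeasurable]
    exact (hl'.add hint).congr heq.symm
  · unfold push
    rw [integral_map hTm.aemeasurable hlm.aestronglyMeasurable, integral_congr_ae heq,
      integral_add hl' hint, hval, integral_fun_fst (fun x : ℝ × ℝ => Real.log (x.2 - x.1))]
    simp

end Push

/-! ### Uniqueness of the stationary law of the squared volatility -/

section Uniqueness

variable {ρ : Measure ℝ} [IsProbabilityMeasure ρ] {α β γ δ : ℝ}

/-- One step is a sum of two independent terms, `β v` and a function of the innovation. -/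
lemma charFun_volPush (μ : Measure ℝ) [IsProbabilityMeasure μ] (t : ℝ) :
    charFun (volPush ρ α β γ δ μ) t =
      charFun μ (β * t) * charFun (ρ.map fun e => α + γ * (e - δ) ^ 2) t := by
  have h1 : volPush ρ α β γ δ μ = ((μ.map (β * ·)).prod
      (ρ.map fun e => α + γ * (e - δ) ^ 2)).map fun p => p.1 + p.2 := by
    rw [Measure.map_prod_map _ _ (by fun_prop) (by fun_prop),
      Measure.map_map (by fun_prop) (by fun_prop)]
    unfold volPush
    congr 1
    ext p
    simp [volStep, add_comm]
  have : IsProbabilityMeasure (μ.map (β * ·)) :=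
    Measure.isProbabilityMeasure_map (by fun_prop)
  have : IsProbabilityMeasure (ρ.map fun e => α + γ * (e - δ) ^ 2) :=
    Measure.isProbabilityMeasure_map (by fun_prop)
  rw [h1, charFun_map_add_prod_eq_mul, Pi.mul_apply, charFun_map_mul]

/-- The difference of the characteristic functions at `t` is dominated by that at `β t`, hence at `β
^ n t → 0`, where both equal `1`. No moment assumption is needed. -/
lemma eq_of_volPush_eq (hβ : 0 < β) (hβ1 : β < 1) {μ₁ μ₂ : Measure ℝ} [IsProbabilityMeasure μ₁]
    [IsProbabilityMeasure μ₂] (h₁ : volPush ρ α β γ δ μ₁ = μ₁)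
    (h₂ : volPush ρ α β γ δ μ₂ = μ₂) : μ₁ = μ₂ := by
  have : IsProbabilityMeasure (ρ.map fun e => α + γ * (e - δ) ^ 2) :=
    Measure.isProbabilityMeasure_map (by fun_prop)
  refine Measure.ext_of_charFun (funext fun t => ?_)
  have hstep : ∀ t, ‖charFun μ₁ t - charFun μ₂ t‖ ≤
      ‖charFun μ₁ (β * t) - charFun μ₂ (β * t)‖ := by
    intro t
    have e1 := charFun_volPush (ρ := ρ) (α := α) (β := β) (γ := γ) (δ := δ) μ₁ t
    have e2 := charFun_volPush (ρ := ρ) (α := α) (β := β) (γ := γ) (δ := δ) μ₂ t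
    rw [h₁] at e1
    rw [h₂] at e2
    rw [e1, e2, ← sub_mul, norm_mul]
    exact mul_le_of_le_one_right (norm_nonneg _) (norm_charFun_le_one t)
  have hiter : ∀ n : ℕ, ‖charFun μ₁ t - charFun μ₂ t‖ ≤
      ‖charFun μ₁ (β ^ n * t) - charFun μ₂ (β ^ n * t)‖ := by
    intro n
    induction n with
    | zero => simp
    | succ n ih =>
      refine ih.trans ((hstep _).trans_eq ?_)
      rw [← mul_assoc, ← pow_succ']
  have hlim : Tendsto (fun n : ℕ => ‖charFun μ₁ (β ^ n * t) - charFun μ₂ (β ^ n * t)‖) atTop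
      (𝓝 ‖charFun μ₁ (0 * t) - charFun μ₂ (0 * t)‖) := by
    have h0 := (tendsto_pow_atTop_nhds_zero_of_lt_one hβ.le hβ1).mul_const t
    exact (((continuous_charFun.tendsto _).comp h0).sub
      ((continuous_charFun.tendsto _).comp h0)).norm
  have h := ge_of_tendsto' hlim hiter
  simp only [zero_mul, charFun_zero, probReal_univ, sub_self, norm_zero] at h
  exact sub_eq_zero.1 (norm_le_zero_iff.1 h)

end Uniqueness

/-! ### Cesàro averages of measures -/

section Cesaro

variable {E : Type*} [MeasurableSpace E]

/-- The average of the first `n + 1` measures of a sequence. -/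
noncomputable def cesaro (m : ℕ → Measure E) (n : ℕ) : Measure E :=
  ((n : ENNReal) + 1)⁻¹ • ∑ k ∈ Finset.range (n + 1), m k

variable {m : ℕ → Measure E}

instance [∀ n, IsProbabilityMeasure (m n)] (n : ℕ) : IsProbabilityMeasure (cesaro m n) := by
  constructor
  simp only [cesaro, Measure.smul_apply, Measure.finsetSum_apply, measure_univ, smul_eq_mul,
    Finset.sum_const, Finset.card_range, nsmul_eq_mul, mul_one, Nat.cast_add, Nat.cast_one]
  exact ENNReal.inv_mul_cancel (by positivity) (by finiteness)

lemma integral_cesaro {f : E → ℝ} (hf : ∀ n, Integrable f (m n)) (n : ℕ) :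
    ∫ x, f x ∂(cesaro m n) = ((n : ℝ) + 1)⁻¹ * ∑ k ∈ Finset.range (n + 1), ∫ x, f x ∂(m k) := by
  rw [cesaro, integral_smul_measure, integral_finsetSum_measure fun k _ => hf k, smul_eq_mul,
    ENNReal.toReal_inv, ENNReal.toReal_add (by simp) (by simp)]
  simp

lemma integrable_cesaro {f : E → ℝ} (hf : ∀ n, Integrable f (m n)) (n : ℕ) :
    Integrable f (cesaro m n) :=
  (integrable_finsetSum_measure.2 fun k _ => hf k).smul_measure (by simp)

lemma integral_cesaro_le {f : E → ℝ} (hf : ∀ n, Integrable f (m n)) {C : ℝ}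
    (hC : ∀ n, ∫ x, f x ∂(m n) ≤ C) (n : ℕ) : ∫ x, f x ∂(cesaro m n) ≤ C := by
  rw [integral_cesaro hf, inv_mul_le_iff₀ (by positivity)]
  calc _ ≤ ∑ k ∈ Finset.range (n + 1), C := Finset.sum_le_sum fun k _ => hC k
    _ = _ := by simp

lemma integral_cesaro_of_const {f : E → ℝ} (hf : ∀ n, Integrable f (m n)) {C : ℝ}
    (hC : ∀ n, ∫ x, f x ∂(m n) = C) (n : ℕ) : ∫ x, f x ∂(cesaro m n) = C := by
  have : (n : ℝ) + 1 ≠ 0 := by positivity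
  rw [integral_cesaro hf, Finset.sum_congr rfl fun k _ => hC k]
  simp
  field_simp

/-- If the increments of `n ↦ ∫ g d(m n)` are the integrals of `f`, then the averages of `f`
telescope. -/
lemma integral_cesaro_telescope {f : E → ℝ} (hf : ∀ n, Integrable f (m n)) {a : ℕ → ℝ}
    (ha : ∀ n, a (n + 1) = a n + ∫ x, f x ∂(m n)) (n : ℕ) :
    ∫ x, f x ∂(cesaro m n) = ((n : ℝ) + 1)⁻¹ * (a (n + 1) - a 0) := by
  rw [integral_cesaro hf, ← Finset.sum_range_sub]
  congr 1
  exact Finset.sum_congr rfl fun k _ => by rw [ha k]; ring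

end Cesaro

/-- A limit point along an ultrafilter of probability measures on the plane with uniformly
bounded integrals of `|x| + |y|`. -/
lemma exists_tendsto_of_integral_le {m : ℕ → ProbabilityMeasure (ℝ × ℝ)} {C : ℝ}
    (hint : ∀ n, Integrable (fun x : ℝ × ℝ => |x.1| + |x.2|) (m n : Measure (ℝ × ℝ)))
    (hC : ∀ n, ∫ x, (|x.1| + |x.2|) ∂(m n : Measure (ℝ × ℝ)) ≤ C) :
    ∃ ν : ProbabilityMeasure (ℝ × ℝ), Tendsto m (hyperfilter ℕ : Filter ℕ) (𝓝 ν) := by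
  have hC0 : 0 ≤ C := (integral_nonneg fun x => by positivity).trans (hC 0)
  have htight : IsTightMeasureSet {((μ : ProbabilityMeasure (ℝ × ℝ)) : Measure (ℝ × ℝ)) |
      μ ∈ range m} := by
    rw [isTightMeasureSet_iff_exists_isCompact_measure_compl_le]
    intro ε hε
    -- Radius for which Markov's inequality leaves mass at most `C / r ≤ ε` outside the ball.
    obtain ⟨r, hr, hrε⟩ : ∃ r : ℝ, 0 < r ∧ ENNReal.ofReal (C / r) ≤ ε := by
      rcases eq_or_ne ε ⊤ with rfl | hε'
      · exact ⟨1, one_pos, le_top⟩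
      · have h0 : 0 < ε.toReal := ENNReal.toReal_pos hε.ne' hε'
        refine ⟨(C + 1) / ε.toReal, by positivity, ?_⟩
        refine ENNReal.ofReal_le_of_le_toReal ?_
        rw [div_div_eq_mul_div, div_le_iff₀ (by positivity)]
        nlinarith
    refine ⟨Metric.closedBall 0 r, isCompact_closedBall _ _, ?_⟩
    rintro _ ⟨_, ⟨n, rfl⟩, rfl⟩
    refine le_trans ?_ hrε
    have hsub : (Metric.closedBall (0 : ℝ × ℝ) r)ᶜ ⊆ {x | r ≤ |x.1| + |x.2|} := by
      intro x hx
      simp only [mem_compl_iff, Metric.mem_closedBall, dist_zero_right, not_le] at hx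
      refine hx.le.trans ?_
      rw [Prod.norm_def, Real.norm_eq_abs, Real.norm_eq_abs]
      exact max_le (by linarith [abs_nonneg x.2]) (by linarith [abs_nonneg x.1])
    refine (measure_mono hsub).trans ?_
    have := mul_meas_ge_le_integral_of_nonneg (ae_of_all _ fun x : ℝ × ℝ => by positivity)
      (hint n) r
    rw [← ofReal_measureReal]
    refine ENNReal.ofReal_le_ofReal ?_
    rw [le_div_iff₀ hr, mul_comm]
    exact this.trans (hC n)
  have hcomp := isCompact_closure_of_isTightMeasureSet htight
  obtain ⟨ν, -, hν⟩ := isCompact_iff_ultrafilter_le_nhds'.1 hcomp ((hyperfilter ℕ).map m)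
    (Ultrafilter.mem_map.2
      (Filter.mem_of_superset univ_mem fun n _ => subset_closure (mem_range_self n)))
  exact ⟨ν, hν⟩

/-! ### An invariant law of the two-point motion off the diagonal -/

section Operator

variable {ρ : Measure ℝ} [IsProbabilityMeasure ρ] {α β γ δ : ℝ}

lemma measurable_pairStep (hα : 0 < α) :
    Measurable fun p : (ℝ × ℝ) × ℝ => pairStep α β γ δ p.1 p.2 :=
  (continuous_pairStep hα).measurable

lemma isProbabilityMeasure_push (hα : 0 < α) (m : Measure (ℝ × ℝ)) [IsProbabilityMeasure m] :
    IsProbabilityMeasure (push ρ α β γ δ m) :=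
  Measure.isProbabilityMeasure_map (measurable_pairStep hα).aemeasurable

lemma map_fst_push (hα : 0 < α) (m : Measure (ℝ × ℝ)) [SFinite m] :
    (push ρ α β γ δ m).map Prod.fst = volPush ρ α β γ δ (m.map Prod.fst) := by
  have h : (m.map Prod.fst).prod ρ = (m.prod ρ).map (Prod.map Prod.fst id) := by
    rw [← Measure.map_prod_map _ _ measurable_fst measurable_id, Measure.map_id]
  unfold push volPush
  rw [h, Measure.map_map measurable_fst (measurable_pairStep hα),
    Measure.map_map continuous_volStep.measurable (by fun_prop)]
  rfl

lemma ae_push_of_forall {ρ : Measure ℝ} (hα : 0 < α) {m : Measure (ℝ × ℝ)} {S : Set (ℝ × ℝ)}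
    (hS : MeasurableSet S) (hm : ∀ᵐ x ∂m, x ∈ S)
    (hstep : ∀ x ∈ S, ∀ e, pairStep α β γ δ x e ∈ S) :
    ∀ᵐ x ∂(push ρ α β γ δ m), x ∈ S := by
  refine (ae_map_iff (p := (· ∈ S)) (measurable_pairStep hα).aemeasurable hS).2 ?_
  filter_upwards [Measure.quasiMeasurePreserving_fst.ae hm] with p hp using hstep _ hp _

lemma measurableSet_quadrant : MeasurableSet (quadrant α) :=
  (measurableSet_le measurable_const measurable_fst).inter
    (measurableSet_le measurable_const measurable_snd)

lemma integral_push (hα : 0 < α) {m : Measure (ℝ × ℝ)} [IsProbabilityMeasure m]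
    (f : BoundedContinuousFunction (ℝ × ℝ) ℝ) :
    ∫ x, f x ∂(push ρ α β γ δ m) = ∫ x, ∫ e, f (pairStep α β γ δ x e) ∂ρ ∂m := by
  unfold push
  rw [integral_map (measurable_pairStep hα).aemeasurable
    f.continuous.measurable.aestronglyMeasurable, integral_prod]
  exact Integrable.of_bound ((f.continuous.comp
    (continuous_pairStep hα)).measurable.aestronglyMeasurable) ‖f‖
    (ae_of_all _ fun p => f.norm_coe_le_norm _)

/-- The Feller property of the two-point motion. -/
lemma continuous_integral_pairStep (hα : 0 < α) (f : BoundedContinuousFunction (ℝ × ℝ) ℝ) :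
    Continuous fun x => ∫ e, f (pairStep α β γ δ x e) ∂ρ := by
  have hc := f.continuous.comp (continuous_pairStep (β := β) (γ := γ) (δ := δ) hα)
  refine continuous_of_dominated (bound := fun _ => ‖f‖) (fun x => ?_)
    (fun x => ae_of_all _ fun e => f.norm_coe_le_norm _) (integrable_const _)
    (ae_of_all _ fun e => ?_)
  · exact (hc.comp (by fun_prop : Continuous fun e : ℝ => (x, e))).aestronglyMeasurable
  · exact hc.comp (by fun_prop : Continuous fun x : ℝ × ℝ => (x, e))

end Operator

/-- Laws on `[α, ∞)²` off the diagonal, with first marginal `μ` and mean of the second marginal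
at most `B`. -/
structure IsAdmissible (μ : Measure ℝ) (α B : ℝ) (m : Measure (ℝ × ℝ)) : Prop where
  prob : IsProbabilityMeasure m
  map_fst : m.map Prod.fst = μ
  quadrant : ∀ᵐ x ∂m, x ∈ quadrant α
  gap : ∀ᵐ x ∂m, x.2 - x.1 ≠ 0
  integrable_snd : Integrable (fun x : ℝ × ℝ => x.2) m
  integral_snd_le : ∫ x, x.2 ∂m ≤ B
  integrable_log : Integrable (fun x : ℝ × ℝ => Real.log (x.2 - x.1)) m

section Admissible

variable {ρ μ : Measure ℝ} {M α β γ δ B : ℝ} {m : Measure (ℝ × ℝ)}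

lemma IsAdmissible.integrable_fst (h : IsAdmissible μ α B m) (hμ : Integrable (fun v => v) μ) :
    Integrable (fun x : ℝ × ℝ => x.1) m := by
  rw [← h.map_fst] at hμ
  exact (integrable_map_measure aestronglyMeasurable_id measurable_fst.aemeasurable).1 hμ

lemma IsAdmissible.integral_comp_fst (h : IsAdmissible μ α B m) {f : ℝ → ℝ}
    (hf : Measurable f) : ∫ x, f x.1 ∂m = ∫ v, f v ∂μ := by
  rw [← h.map_fst, integral_map measurable_fst.aemeasurable hf.aestronglyMeasurable]

lemma IsAdmissible.integral_add_le (h : IsAdmissible μ α B m) (hα : 0 < α)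
    (hμ : Integrable (fun v => v) μ) :
    Integrable (fun x : ℝ × ℝ => |x.1| + |x.2|) m ∧
      ∫ x, (|x.1| + |x.2|) ∂m ≤ ∫ v, v ∂μ + B := by
  have h1 := h.integrable_fst hμ
  have hint := h1.abs.add h.integrable_snd.abs
  refine ⟨hint, ?_⟩
  have : ∫ x, (|x.1| + |x.2|) ∂m = ∫ x, (x.1 + x.2) ∂m := by
    refine integral_congr_ae ?_
    filter_upwards [h.quadrant] with x hx
    rw [abs_of_nonneg (hα.le.trans hx.1), abs_of_nonneg (hα.le.trans hx.2)]
  rw [this, integral_add h1 h.integrable_snd, h.integral_comp_fst (f := fun v => v) measurable_id]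
  linarith [h.integral_snd_le]

/-- `log |w - v| ≤ |w - v| ≤ |v| + |w|`. Only this upper bound is needed: it keeps the log-gap from
growing linearly. -/
lemma IsAdmissible.integral_log_le (h : IsAdmissible μ α B m) (hα : 0 < α)
    (hμ : Integrable (fun v => v) μ) :
    ∫ x, Real.log (x.2 - x.1) ∂m ≤ ∫ v, v ∂μ + B := by
  refine (integral_mono h.integrable_log (h.integral_add_le hα hμ).1 fun x => ?_).trans
    (h.integral_add_le hα hμ).2
  have h1 := Real.log_le_self (abs_nonneg (x.2 - x.1))
  rw [Real.log_abs] at h1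
  have := abs_sub x.2 x.1
  simp only
  linarith

variable [IsProbabilityMeasure ρ]

/-- The condition `hB` is a Lyapunov inequality: the mean of the second coordinate contracts by `β`,
up to a term in the fixed mean of `μ`, since `E (v e²) = E v` by independence and unit second
moment. -/
lemma IsAdmissible.push (h : IsAdmissible μ α B m) (hM : 0 ≤ M) (hρ : TailBoundedDensity ρ M)
    (hid : Integrable (fun x => x) ρ) (hsq : Integrable (fun x => x ^ 2) ρ)
    (hsq1 : ∫ x, x ^ 2 ∂ρ = 1) (hα : 0 < α) (hβ : 0 < β) (hγ : 0 ≤ γ)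
    (hμ : Integrable (fun v => v) μ) (hinv : volPush ρ α β γ δ μ = μ)
    (hB : (α + 2 * γ * δ ^ 2) + β * B + 2 * γ / α * ∫ v, v ∂μ ≤ B) :
    IsAdmissible μ α B (push ρ α β γ δ m) := by
  have := h.prob
  have hTm := measurable_pairStep (β := β) (γ := γ) (δ := δ) hα
  have h1 := h.integrable_fst hμ
  have hprod : Integrable (fun p : (ℝ × ℝ) × ℝ => p.1.1 * p.2 ^ 2) (m.prod ρ) :=
    Integrable.mul_prod (f := fun x : ℝ × ℝ => x.1) (g := fun e : ℝ => e ^ 2) h1 hsq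
  have hsnd : Integrable (fun p : (ℝ × ℝ) × ℝ => (α + 2 * γ * δ ^ 2) + β * p.1.2) (m.prod ρ) :=
    (integrable_const _).add ((h.integrable_snd.comp_fst ρ).const_mul β)
  have hmaj : Integrable (fun p : (ℝ × ℝ) × ℝ => (α + 2 * γ * δ ^ 2) + β * p.1.2 +
      2 * γ / α * (p.1.1 * p.2 ^ 2)) (m.prod ρ) := hsnd.add (hprod.const_mul _)
  have hq : ∀ᵐ p ∂(m.prod ρ), p.1 ∈ VGARCH.quadrant α :=
    Measure.quasiMeasurePreserving_fst.ae h.quadrant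
  have hint : Integrable (fun p : (ℝ × ℝ) × ℝ => (pairStep α β γ δ p.1 p.2).2) (m.prod ρ) := by
    refine hmaj.mono' (measurable_snd.comp hTm).aestronglyMeasurable ?_
    filter_upwards [hq] with p hp
    rw [Real.norm_of_nonneg (hα.le.trans (pairStep_mem_quadrant hα hβ hγ hp _).2)]
    exact pairStep_snd_le hα hγ hp _
  refine ⟨isProbabilityMeasure_push hα m, ?_, ?_, ?_, ?_, ?_, ?_⟩
  · rw [map_fst_push hα, h.map_fst, hinv]
  · exact ae_push_of_forall hα measurableSet_quadrant h.quadrant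
      fun x hx e => pairStep_mem_quadrant hα hβ hγ hx e
  · have hmeas : MeasurableSet {x : ℝ × ℝ | x.2 - x.1 ≠ 0} :=
      (measurableSet_eq_fun (by fun_prop) measurable_const).compl
    unfold VGARCH.push
    rw [ae_map_iff hTm.aemeasurable hmeas]
    exact ae_push_gap hρ hα hβ hγ h.quadrant h.gap
  · unfold VGARCH.push
    rw [integrable_map_measure measurable_snd.aestronglyMeasurable hTm.aemeasurable]
    exact hint
  · unfold VGARCH.push
    rw [integral_map hTm.aemeasurable measurable_snd.aestronglyMeasurable]
    refine (integral_mono_ae hint hmaj ?_).trans (le_trans ?_ hB)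
    · filter_upwards [hq] with p hp using pairStep_snd_le hα hγ hp _
    · rw [integral_add hsnd (hprod.const_mul _), integral_const_mul,
        integral_prod_mul (fun x : ℝ × ℝ => x.1) (fun e : ℝ => e ^ 2), hsq1,
        h.integral_comp_fst (f := fun v => v) measurable_id, mul_one,
        integral_add (integrable_const _) ((h.integrable_snd.comp_fst ρ).const_mul β),
        integral_const_mul, integral_fun_fst (fun x : ℝ × ℝ => x.2)]
      have := mul_le_mul_of_nonneg_left h.integral_snd_le hβ.le
      simp only [integral_const, probReal_univ, smul_eq_mul, one_mul]
      linarith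
  · exact (integral_push_log_gap hM hρ hid hα hβ hγ h.quadrant h.gap h.integrable_log).1

/-- The law of `(v, v + 1)` is admissible. -/
lemma isAdmissible_initial [IsProbabilityMeasure μ] (hμ : Integrable (fun v => v) μ)
    (hμα : ∀ᵐ v ∂μ, α ≤ v) (hB : ∫ v, v ∂μ + 1 ≤ B) :
    IsAdmissible μ α B (μ.map fun v => (v, v + 1)) := by
  have hT : Measurable fun v : ℝ => (v, v + 1) := by fun_prop
  have hlm : Measurable fun x : ℝ × ℝ => Real.log (x.2 - x.1) := by fun_prop
  refine ⟨Measure.isProbabilityMeasure_map hT.aemeasurable, ?_, ?_, ?_, ?_, ?_, ?_⟩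
  · rw [Measure.map_map measurable_fst hT]
    exact Measure.map_id
  · refine (ae_map_iff (p := (· ∈ quadrant α)) hT.aemeasurable measurableSet_quadrant).2 ?_
    filter_upwards [hμα] with v hv
    exact ⟨hv, by simp only; linarith⟩
  · have hmeas : MeasurableSet {x : ℝ × ℝ | x.2 - x.1 ≠ 0} :=
      (measurableSet_eq_fun (by fun_prop) measurable_const).compl
    rw [ae_map_iff hT.aemeasurable hmeas]
    exact ae_of_all _ fun v => by simp
  · rw [integrable_map_measure measurable_snd.aestronglyMeasurable hT.aemeasurable]
    exact hμ.add (integrable_const 1)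
  · rw [integral_map hT.aemeasurable measurable_snd.aestronglyMeasurable]
    simp only
    rw [integral_add hμ (integrable_const 1)]
    simpa using hB
  · rw [integrable_map_measure hlm.aestronglyMeasurable hT.aemeasurable]
    refine (integrable_const (0 : ℝ)).congr (ae_of_all _ fun v => ?_)
    simp

/-- Restricting an invariant law of the two-point motion to the complement of the diagonal
gives an invariant law. -/
lemma push_cond_off_diag (hα : 0 < α) (hβ : 0 < β) (hγ : 0 ≤ γ)
    {ν : Measure (ℝ × ℝ)} [IsProbabilityMeasure ν]
    (hq : ∀ᵐ x ∂ν, x ∈ quadrant α) (hinv : VGARCH.push ρ α β γ δ ν = ν) :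
    VGARCH.push ρ α β γ δ (ν[|{x | x.1 ≠ x.2}]) = ν[|{x | x.1 ≠ x.2}] := by
  set D : Set (ℝ × ℝ) := {x | x.1 ≠ x.2} with hDdef
  have hD : MeasurableSet D := (measurableSet_eq_fun measurable_fst measurable_snd).compl
  have hTm := measurable_pairStep (β := β) (γ := γ) (δ := δ) hα
  -- By invariance the mass of `ν` on `D` comes from one step of `ν`, and none of it from the
  -- absorbing diagonal. Since a step preserves total mass, the inequality is then an equality.
  have hle : ν.restrict D ≤ VGARCH.push ρ α β γ δ (ν.restrict D) := by
    have hsplit : VGARCH.push ρ α β γ δ (ν.restrict D) +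
        VGARCH.push ρ α β γ δ (ν.restrict Dᶜ) = ν := by
      conv_rhs => rw [← hinv, ← Measure.restrict_add_restrict_compl (μ := ν) hD]
      unfold VGARCH.push
      rw [Measure.add_prod, Measure.map_add _ _ hTm]
    have hnull : VGARCH.push ρ α β γ δ (ν.restrict Dᶜ) D = 0 := by
      have h1 : ∀ᵐ x ∂(VGARCH.push ρ α β γ δ (ν.restrict Dᶜ)), x ∈ Dᶜ ∩ quadrant α := by
        refine ae_push_of_forall hα (hD.compl.inter measurableSet_quadrant) ?_ ?_
        · filter_upwards [ae_restrict_mem hD.compl, ae_restrict_of_ae hq] with x h1 h2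
            using ⟨h1, h2⟩
        · rintro x ⟨h1, h2⟩ e
          have hx : x.1 = x.2 := by simpa [hDdef] using h1
          have hd := pairStep_diag (β := β) (γ := γ) (δ := δ) hα h2 hx e
          exact ⟨by simp [hDdef, hd], pairStep_mem_quadrant hα hβ hγ h2 e⟩
      refine measure_mono_null (fun x hx => ?_) h1
      simp [hx]
    refine Measure.le_iff.2 fun A hA => ?_
    rw [Measure.restrict_apply hA]
    calc ν (A ∩ D) = VGARCH.push ρ α β γ δ (ν.restrict D) (A ∩ D) +
          VGARCH.push ρ α β γ δ (ν.restrict Dᶜ) (A ∩ D) := by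
          conv_lhs => rw [← hsplit]
          rfl
      _ = VGARCH.push ρ α β γ δ (ν.restrict D) (A ∩ D) := by
          rw [measure_mono_null inter_subset_right hnull, add_zero]
      _ ≤ _ := measure_mono inter_subset_left
  have heq : ν.restrict D = VGARCH.push ρ α β γ δ (ν.restrict D) := by
    refine Measure.eq_of_le_of_measure_univ_eq hle ?_
    unfold VGARCH.push
    rw [Measure.map_apply hTm MeasurableSet.univ, preimage_univ,
      ← univ_prod_univ (α := ℝ × ℝ) (β := ℝ), Measure.prod_prod, measure_univ (μ := ρ), mul_one]
  unfold ProbabilityTheory.cond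
  conv_rhs => rw [heq]
  unfold VGARCH.push
  rw [Measure.prod_smul_left, Measure.map_smul]

end Admissible

/-! ### Krylov–Bogoliubov construction and conditioning off the diagonal -/

section Invariant

variable {ρ μ : Measure ℝ} [IsProbabilityMeasure ρ] [IsProbabilityMeasure μ] {M α β γ δ : ℝ}

/-- There is an invariant law of the two-point motion with first marginal `μ` and nonpositive mean
drift: a limit of the averaged laws of the motion started from `(v, v + 1)`. -/
lemma exists_invariant_drift_nonpos (hM : 0 ≤ M) (hρ : TailBoundedDensity ρ M)
    (hid : Integrable (fun x => x) ρ) (hsq : Integrable (fun x => x ^ 2) ρ)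
    (hsq1 : ∫ x, x ^ 2 ∂ρ = 1) (hα : 0 < α) (hβ : 0 < β) (hβ1 : β < 1) (hγ : 0 ≤ γ)
    (hμ : Integrable (fun v => v) μ) (hμα : ∀ᵐ v ∂μ, α ≤ v)
    (hinv : volPush ρ α β γ δ μ = μ) :
    ∃ ν : Measure (ℝ × ℝ), IsProbabilityMeasure ν ∧ ν.map Prod.fst = μ ∧
      (∀ᵐ x ∂ν, x ∈ quadrant α) ∧ push ρ α β γ δ ν = ν ∧ ∫ x, drift ρ α β γ δ x ∂ν ≤ 0 := by
  set V := ∫ v, v ∂μ with hV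
  have hV0 : 0 ≤ V := integral_nonneg_of_ae (by
    filter_upwards [hμα] with v hv using hα.le.trans hv)
  set K := (α + 2 * γ * δ ^ 2) + 2 * γ / α * V with hK
  have hK0 : 0 ≤ K := by positivity
  have hβ' : 0 < 1 - β := by linarith
  -- `V + 1` covers the mean of the starting point, and `K / (1 - β)` is the fixed point of `b ↦ K +
  -- β b`.
  set B := V + 1 + K / (1 - β) with hBdef
  have hB : (α + 2 * γ * δ ^ 2) + β * B + 2 * γ / α * V ≤ B := by
    have h1 : K / (1 - β) * (1 - β) = K := div_mul_cancel₀ _ hβ'.ne'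
    nlinarith [mul_nonneg (by linarith : 0 ≤ V + 1) hβ'.le]
  set m : ℕ → Measure (ℝ × ℝ) := fun n =>
    (push ρ α β γ δ)^[n] (μ.map fun v => (v, v + 1)) with hm
  have hsucc : ∀ n, m (n + 1) = push ρ α β γ δ (m n) := fun n =>
    Function.iterate_succ_apply' _ _ _
  have hadm : ∀ n, IsAdmissible μ α B (m n) := by
    intro n
    induction n with
    | zero => exact isAdmissible_initial hμ hμα (by
        have := div_nonneg hK0 hβ'.le
        linarith)
    | succ n ih =>
      rw [hsucc]
      exact ih.push hM hρ hid hsq hsq1 hα hβ hγ hμ hinv hB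
  have hprob : ∀ n, IsProbabilityMeasure (m n) := fun n => (hadm n).prob
  have hbint : ∀ (f : BoundedContinuousFunction (ℝ × ℝ) ℝ) (n : ℕ), Integrable f (m n) :=
    fun f n => f.integrable _
  set c : ℕ → ProbabilityMeasure (ℝ × ℝ) := fun n => ⟨cesaro m n, inferInstance⟩ with hc
  obtain ⟨ν, hν⟩ := exists_tendsto_of_integral_le (m := c) (C := V + B)
    (fun n => integrable_cesaro (fun k => ((hadm k).integral_add_le hα hμ).1) n)
    (fun n => integral_cesaro_le (fun k => ((hadm k).integral_add_le hα hμ).1)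
      (fun k => ((hadm k).integral_add_le hα hμ).2) n)
  have hlim : ∀ f : BoundedContinuousFunction (ℝ × ℝ) ℝ,
      Tendsto (fun n => ∫ x, f x ∂(cesaro m n)) (hyperfilter ℕ : Filter ℕ)
        (𝓝 (∫ x, f x ∂(ν : Measure (ℝ × ℝ)))) :=
    ProbabilityMeasure.tendsto_iff_forall_integral_tendsto.1 hν
  have hconst : ∀ (f : BoundedContinuousFunction (ℝ × ℝ) ℝ) (C : ℝ),
      (∀ n, ∫ x, f x ∂(m n) = C) → ∫ x, f x ∂(ν : Measure (ℝ × ℝ)) = C := by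
    intro f C hC
    refine tendsto_nhds_unique (hlim f) ?_
    simp_rw [integral_cesaro_of_const (hbint f) hC]
    exact tendsto_const_nhds
  have hzero : ∀ C : ℝ, Tendsto (fun n : ℕ => ((n : ℝ) + 1)⁻¹ * C)
      (hyperfilter ℕ : Filter ℕ) (𝓝 0) := by
    intro C
    have h1 := (tendsto_one_div_add_atTop_nhds_zero_nat (𝕜 := ℝ)).mul_const C
    simp only [one_div, zero_mul] at h1
    exact h1.mono_left Nat.hyperfilter_le_atTop
  refine ⟨ν, inferInstance, ?_, ?_, ?_, ?_⟩
  · have : IsProbabilityMeasure ((ν : Measure (ℝ × ℝ)).map Prod.fst) :=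
      Measure.isProbabilityMeasure_map measurable_fst.aemeasurable
    refine ext_of_forall_integral_eq_of_IsFiniteMeasure fun f => ?_
    rw [integral_map measurable_fst.aemeasurable f.continuous.measurable.aestronglyMeasurable]
    exact hconst (f.compContinuous ⟨Prod.fst, continuous_fst⟩) _ fun n =>
      (hadm n).integral_comp_fst f.continuous.measurable
  -- A bounded continuous function vanishing exactly on `quadrant α`, so that support in the
  -- quadrant passes to the weak limit.
  · let d : ℝ × ℝ → ℝ := fun x => min 1 (max (α - x.1) 0 + max (α - x.2) 0)
    have hd0 : ∀ x, 0 ≤ d x := fun x => le_min zero_le_one (by positivity)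
    have hdc : Continuous d := by fun_prop
    let f := BoundedContinuousFunction.ofNormedAddCommGroup d hdc 1 fun x => by
      rw [Real.norm_of_nonneg (hd0 x)]; exact min_le_left _ _
    have hf : ∫ x, f x ∂(ν : Measure (ℝ × ℝ)) = 0 := by
      refine hconst f 0 fun n => ?_
      refine integral_eq_zero_of_ae ?_
      filter_upwards [(hadm n).quadrant] with x hx
      have h1 : max (α - x.1) 0 = 0 := max_eq_right (by linarith [hx.1])
      have h2 : max (α - x.2) 0 = 0 := max_eq_right (by linarith [hx.2])
      simp [f, d, h1, h2]
    have hae := (integral_eq_zero_iff_of_nonneg (fun x => hd0 x) (f.integrable _)).1 hf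
    filter_upwards [hae] with x hx
    have hx' : min 1 (max (α - x.1) 0 + max (α - x.2) 0) = 0 := hx
    have h1 := le_max_right (α - x.1) 0
    have h2 := le_max_right (α - x.2) 0
    have h3 : max (α - x.1) 0 + max (α - x.2) 0 ≤ 0 := by
      by_contra h
      push Not at h
      exact (lt_min one_pos h).ne' hx'
    constructor
    · linarith [le_max_left (α - x.1) 0]
    · linarith [le_max_left (α - x.2) 0]
  · have := isProbabilityMeasure_push (ρ := ρ) (β := β) (γ := γ) (δ := δ) hα
      (ν : Measure (ℝ × ℝ))
    refine ext_of_forall_integral_eq_of_IsFiniteMeasure fun f => ?_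
    rw [integral_push hα]
    -- By the Feller property `U f - f` is a legitimate test function; its Cesàro averages telescope
    -- and tend to `0`.
    have hUc := continuous_integral_pairStep (ρ := ρ) (β := β) (γ := γ) (δ := δ) hα f
    let U := BoundedContinuousFunction.ofNormedAddCommGroup _ hUc ‖f‖ fun x => by
      refine (norm_integral_le_of_norm_le_const (ae_of_all _ fun e =>
        f.norm_coe_le_norm _)).trans ?_
      simp
    have hdiff : ∀ n, ∫ x, (U - f) x ∂(cesaro m n) =
        ((n : ℝ) + 1)⁻¹ * (∫ x, f x ∂(m (n + 1)) - ∫ x, f x ∂(m 0)) := by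
      refine integral_cesaro_telescope (hbint (U - f)) (a := fun n => ∫ x, f x ∂(m n)) ?_
      intro n
      have h1 : ∫ x, f x ∂(m (n + 1)) = ∫ x, U x ∂(m n) := by
        rw [hsucc, integral_push hα]
        rfl
      have h2 : ∫ x, (U - f) x ∂(m n) = ∫ x, U x ∂(m n) - ∫ x, f x ∂(m n) :=
        integral_sub (hbint U n) (hbint f n)
      rw [h1, h2]
      ring
    have hbound : ∀ n, |∫ x, (U - f) x ∂(cesaro m n)| ≤ ((n : ℝ) + 1)⁻¹ * (‖f‖ + ‖f‖) := by
      intro n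
      rw [hdiff, abs_mul, abs_of_nonneg (by positivity : 0 ≤ ((n : ℝ) + 1)⁻¹)]
      gcongr
      refine (abs_sub _ _).trans (add_le_add ?_ ?_)
      · exact (norm_integral_le_of_norm_le_const (ae_of_all _ fun x =>
          f.norm_coe_le_norm x)).trans (by simp)
      · exact (norm_integral_le_of_norm_le_const (ae_of_all _ fun x =>
          f.norm_coe_le_norm x)).trans (by simp)
    have h0 := tendsto_nhds_unique (hlim (U - f))
      (squeeze_zero_norm hbound (hzero _))
    have h2 : ∫ x, (U - f) x ∂(ν : Measure (ℝ × ℝ)) =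
        ∫ x, U x ∂(ν : Measure (ℝ × ℝ)) - ∫ x, f x ∂(ν : Measure (ℝ × ℝ)) :=
      integral_sub (U.integrable _) (f.integrable _)
    rw [h2] at h0
    exact sub_eq_zero.1 h0
  · obtain ⟨C, hC⟩ := exists_abs_drift_le (δ := δ) hM hρ hid hα hβ hγ
    -- The averaged drift is the total increase of the mean log-gap divided by `n + 1`. That
    -- increase is bounded above, so the limit is nonpositive.
    let f := BoundedContinuousFunction.ofNormedAddCommGroup (drift ρ α β γ δ)
      (continuous_drift hM hρ hid hα hβ) C hC
    have htel : ∀ n, ∫ x, f x ∂(cesaro m n) = ((n : ℝ) + 1)⁻¹ *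
        (∫ x, Real.log (x.2 - x.1) ∂(m (n + 1)) - ∫ x, Real.log (x.2 - x.1) ∂(m 0)) := by
      refine integral_cesaro_telescope (hbint f)
        (a := fun n => ∫ x, Real.log (x.2 - x.1) ∂(m n)) fun n => ?_
      rw [hsucc]
      exact (integral_push_log_gap hM hρ hid hα hβ hγ (hadm n).quadrant (hadm n).gap
        (hadm n).integrable_log).2
    have h0 : ∫ x, Real.log (x.2 - x.1) ∂(m 0) = 0 := by
      have hlm : Measurable fun x : ℝ × ℝ => Real.log (x.2 - x.1) := by fun_prop
      change ∫ x, Real.log (x.2 - x.1) ∂(μ.map fun v => (v, v + 1)) = 0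
      rw [integral_map (by fun_prop) hlm.aestronglyMeasurable]
      simp
    refine le_of_tendsto_of_tendsto' (hlim f) (hzero (V + B)) fun n => ?_
    rw [htel, h0, sub_zero]
    have := (hadm (n + 1)).integral_log_le hα hμ
    gcongr

/-- If the mean drift along the diagonal is positive, there is an invariant law of the two-point
motion that does not charge the diagonal. -/
lemma exists_invariant_off_diag (hM : 0 ≤ M) (hρ : TailBoundedDensity ρ M)
    (hid : Integrable (fun x => x) ρ) (hsq : Integrable (fun x => x ^ 2) ρ)
    (hsq1 : ∫ x, x ^ 2 ∂ρ = 1) (hα : 0 < α) (hβ : 0 < β) (hβ1 : β < 1) (hγ : 0 ≤ γ)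
    (hμ : Integrable (fun v => v) μ) (hμα : ∀ᵐ v ∂μ, α ≤ v)
    (hinv : volPush ρ α β γ δ μ = μ) (hpos : 0 < ∫ v, drift ρ α β γ δ (v, v) ∂μ) :
    ∃ ν : Measure (ℝ × ℝ), IsProbabilityMeasure ν ∧ ν.map Prod.fst = μ ∧
      (∀ᵐ x ∂ν, x ∈ quadrant α) ∧ push ρ α β γ δ ν = ν ∧ ∀ᵐ x ∂ν, x.1 ≠ x.2 := by
  obtain ⟨ν, hνp, hfst, hq, hνinv, hneg⟩ :=
    exists_invariant_drift_nonpos hM hρ hid hsq hsq1 hα hβ hβ1 hγ hμ hμα hinv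
  have hDm : MeasurableSet {x : ℝ × ℝ | x.1 ≠ x.2} :=
    (measurableSet_eq_fun measurable_fst measurable_snd).compl
  have hD : ν {x | x.1 ≠ x.2} ≠ 0 := by
    intro h0
    have hdiag : ∀ᵐ x ∂ν, x.1 = x.2 := by
      rw [ae_iff]
      exact h0
    have hdm : Measurable fun v : ℝ => drift ρ α β γ δ (v, v) :=
      ((continuous_drift hM hρ hid hα hβ).comp (by fun_prop)).measurable
    have heq : ∫ x, drift ρ α β γ δ x ∂ν = ∫ v, drift ρ α β γ δ (v, v) ∂μ := by
      rw [← hfst, integral_map measurable_fst.aemeasurable hdm.aestronglyMeasurable]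
      refine integral_congr_ae ?_
      filter_upwards [hdiag] with x hx
      conv_rhs => rw [show (x.1, x.1) = x from Prod.ext rfl hx]
    linarith
  have hcp : IsProbabilityMeasure (ν[|{x | x.1 ≠ x.2}]) := cond_isProbabilityMeasure hD
  have hcinv := push_cond_off_diag (ρ := ρ) (δ := δ) hα hβ hγ hq hνinv
  refine ⟨ν[|{x | x.1 ≠ x.2}], hcp, ?_, cond_absolutelyContinuous.ae_le hq, hcinv,
    ae_cond_mem hDm⟩
  have : IsProbabilityMeasure ((ν[|{x | x.1 ≠ x.2}]).map Prod.fst) :=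
    Measure.isProbabilityMeasure_map measurable_fst.aemeasurable
  -- Conditioning could have altered the first marginal, but it is still invariant for the
  -- volatility step, so uniqueness gives `μ` back.
  refine eq_of_volPush_eq hβ hβ1 ?_ hinv
  rw [← map_fst_push hα, hcinv]

end Invariant

/-! ### Stationary solutions of the volatility equation -/

/-- The series `∑ β^k (α + γ (e k - δ)²)` with values in `[0, ∞]`. -/
noncomputable def volSeries (α β γ δ : ℝ) (e : ℕ → ℝ) : ENNReal :=
  ∑' k, ENNReal.ofReal (β ^ k * (α + γ * (e k - δ) ^ 2))

section Series

variable {α β γ δ : ℝ}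

lemma measurable_volSeries : Measurable (volSeries α β γ δ) := by
  refine Measurable.tsum fun k => ENNReal.measurable_ofReal.comp ?_
  fun_prop

lemma volSeries_succ (hβ : 0 < β) (e : ℕ → ℝ) :
    volSeries α β γ δ e = ENNReal.ofReal (α + γ * (e 0 - δ) ^ 2) +
      ENNReal.ofReal β * volSeries α β γ δ fun k => e (k + 1) := by
  unfold volSeries
  rw [tsum_eq_zero_add' ENNReal.summable, ← ENNReal.tsum_mul_left]
  congr 1
  · simp
  · refine tsum_congr fun k => ?_
    rw [← ENNReal.ofReal_mul hβ.le, pow_succ', mul_assoc]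

lemma toReal_volSeries_succ (hα : 0 < α) (hβ : 0 < β) (hγ : 0 ≤ γ) {e : ℕ → ℝ}
    (hfin : volSeries α β γ δ e ≠ ⊤) :
    (volSeries α β γ δ e).toReal =
      volStep α β γ δ (volSeries α β γ δ fun k => e (k + 1)).toReal (e 0) := by
  rw [volSeries_succ hβ] at hfin ⊢
  have h2 := (ENNReal.add_ne_top.1 hfin).2
  rw [ENNReal.toReal_add ENNReal.ofReal_ne_top h2, ENNReal.toReal_mul,
    ENNReal.toReal_ofReal hβ.le, ENNReal.toReal_ofReal (by positivity)]
  rfl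

lemma le_toReal_volSeries (hα : 0 < α) (hβ : 0 < β) (hγ : 0 ≤ γ) {e : ℕ → ℝ}
    (hfin : volSeries α β γ δ e ≠ ⊤) : α ≤ (volSeries α β γ δ e).toReal := by
  rw [toReal_volSeries_succ hα hβ hγ hfin]
  have : 0 ≤ β * (volSeries α β γ δ fun k => e (k + 1)).toReal :=
    mul_nonneg hβ.le ENNReal.toReal_nonneg
  have := mul_nonneg hγ (sq_nonneg (e 0 - δ))
  unfold volStep
  linarith

end Series

section Innovations

variable {Ω : Type u} [MeasurableSpace Ω] {P : Measure Ω}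
  {ε : ℤ → Ω → ℝ} {α β γ δ : ℝ}

lemma comap_block_le {Ω ι : Type*} {ε : ℤ → Ω → ℝ} (f : ι → ℤ) :
    MeasurableSpace.comap (fun ω i => ε (f i) ω) MeasurableSpace.pi ≤
      ⨆ t ∈ range f, MeasurableSpace.comap (ε t) inferInstance := by
  refine Measurable.comap_le ?_
  refine @measurable_pi_lambda _ _ _ (_) _ _ fun i => ?_
  exact (comap_measurable (ε (f i))).mono
    (le_iSup₂_of_le (f i) (mem_range_self i) le_rfl) le_rfl

/-- Blocks of innovations with disjoint time sets are independent. -/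
lemma indepFun_blocks {ι κ : Type*} (hε : IsIIDInnovations P ε) (f : ι → ℤ) (g : κ → ℤ)
    (hfg : ∀ i j, f i ≠ g j) :
    IndepFun (fun ω i => ε (f i) ω) (fun ω j => ε (g j) ω) P := by
  have hind := indep_iSup_of_disjoint (μ := P) (S := range f) (T := range g)
    (fun t => (hε.measurable t).comap_le) hε.indep (by
      rw [Set.disjoint_left]
      rintro _ ⟨i, rfl⟩ ⟨j, hj⟩
      exact hfg i j hj.symm)
  exact indep_of_indep_of_le_left (indep_of_indep_of_le_right hind
    (comap_block_le g)) (comap_block_le f)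

/-- The law of a family of innovations with distinct times is the product law. -/
lemma map_innovations (hε : IsIIDInnovations P ε) {ι : Type*} [Countable ι] {f : ι → ℤ}
    (hf : Function.Injective f) :
    P.map (fun ω i => ε (f i) ω) = Measure.infinitePi fun _ : ι => P.map (ε 0) := by
  have h := (hε.indep.precomp hf).map_fun_eq_infinitePi_map fun i => hε.measurable (f i)
  rw [h]
  congr 1
  funext i
  exact (hε.identDistrib (f i)).map_eq

/-- The candidate for the stationary solution. -/
noncomputable def seriesVol (ε : ℤ → Ω → ℝ) (α β γ δ : ℝ) (t : ℤ) (ω : Ω) : ℝ :=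
  (volSeries α β γ δ fun k => ε (t - 1 - k) ω).toReal

lemma measurable_volSeries_innovations (hε : IsIIDInnovations P ε) (t : ℤ) :
    Measurable fun ω => volSeries α β γ δ fun k => ε (t - 1 - k) ω :=
  measurable_volSeries.comp (measurable_pi_lambda _ fun _ => hε.measurable _)

variable {v v' : ℤ → Ω → ℝ}

/-- The functional `min 1 |·|` stands in for the modulus because an arbitrary stationary solution is
not yet known to be integrable. -/
lemma integral_min_stationary (hv : IsStationaryVGARCH P ε α β γ δ v) (n : ℕ) :
    ∫ ω, min 1 |β ^ n * v (-n) ω| ∂P = ∫ ω, min 1 |β ^ n * v 0 ω| ∂P := by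
  have h := (hv.stationary (-n)).comp (u := fun x : ℤ → ℝ => min 1 |β ^ n * x 0|)
    (by fun_prop)
  simpa [Function.comp_def] using h.integral_eq

variable [IsProbabilityMeasure P]

lemma lintegral_volSeries_ne_top (hε : IsIIDInnovations P ε) (hreg : RegularInnovation P (ε 0))
    (hβ : 0 < β) (hβ1 : β < 1) (t : ℤ) :
    ∫⁻ ω, volSeries α β γ δ (fun k => ε (t - 1 - k) ω) ∂P ≠ ⊤ := by
  have hm : ∀ k : ℕ, ∀ s : ℤ, Measurable fun ω =>
      ENNReal.ofReal (β ^ k * (α + γ * (ε s ω - δ) ^ 2)) := fun k s => by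
    have := hε.measurable s
    fun_prop
  unfold volSeries
  rw [lintegral_tsum fun k => (hm k _).aemeasurable]
  set I := ∫⁻ ω, ENNReal.ofReal (α + γ * (ε 0 ω - δ) ^ 2) ∂P with hI
  have hint : Integrable (fun ω => α + γ * (ε 0 ω - δ) ^ 2) P := by
    have h1 : MemLp (fun ω => ε 0 ω - δ) 2 P := hreg.memLp_two.sub (memLp_const δ)
    exact (integrable_const α).add (h1.integrable_sq.const_mul γ)
  have hItop : I ≠ ⊤ := by
    have := hint.lintegral_lt_top
    exact this.ne
  have hterm : ∀ k : ℕ, ∫⁻ ω, ENNReal.ofReal (β ^ k * (α + γ * (ε (t - 1 - k) ω - δ) ^ 2)) ∂P =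
      ENNReal.ofReal β ^ k * I := by
    intro k
    have hg : Measurable fun x : ℝ => ENNReal.ofReal (β ^ k * (α + γ * (x - δ) ^ 2)) := by
      fun_prop
    have h1 := lintegral_map (μ := P) hg (hε.measurable (t - 1 - k))
    have h2 := lintegral_map (μ := P) hg (hε.measurable 0)
    rw [(hε.identDistrib (t - 1 - k)).map_eq] at h1
    rw [← h1, h2, hI, ← lintegral_const_mul]
    · simp_rw [ENNReal.ofReal_mul (pow_nonneg hβ.le k), ENNReal.ofReal_pow hβ.le]
    · have := hε.measurable 0
      fun_prop
  simp_rw [hterm]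
  rw [ENNReal.tsum_mul_right, ENNReal.tsum_geometric]
  refine ENNReal.mul_ne_top (ENNReal.inv_ne_top.2 ?_) hItop
  rw [← ENNReal.ofReal_one]
  exact (tsub_pos_of_lt ((ENNReal.ofReal_lt_ofReal_iff one_pos).2 hβ1)).ne'

lemma ae_volSeries_ne_top (hε : IsIIDInnovations P ε) (hreg : RegularInnovation P (ε 0))
    (hβ : 0 < β) (hβ1 : β < 1) :
    ∀ᵐ ω ∂P, ∀ t : ℤ, volSeries α β γ δ (fun k => ε (t - 1 - k) ω) ≠ ⊤ := by
  rw [ae_all_iff]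
  intro t
  filter_upwards [ae_lt_top (measurable_volSeries_innovations hε t)
    (lintegral_volSeries_ne_top hε hreg hβ hβ1 t)] with ω hω using hω.ne

lemma integrable_seriesVol (hε : IsIIDInnovations P ε) (hreg : RegularInnovation P (ε 0))
    (hβ : 0 < β) (hβ1 : β < 1) (t : ℤ) :
    Integrable (seriesVol ε α β γ δ t) P :=
  integrable_toReal_of_lintegral_ne_top (measurable_volSeries_innovations hε t).aemeasurable
    (lintegral_volSeries_ne_top hε hreg hβ hβ1 t)

/-- The series solves the volatility equation and is strictly stationary. -/
lemma isStationaryVGARCH_seriesVol (hε : IsIIDInnovations P ε)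
    (hreg : RegularInnovation P (ε 0)) (hα : 0 < α) (hβ : 0 < β) (hβ1 : β < 1) (hγ : 0 ≤ γ) :
    IsStationaryVGARCH P ε α β γ δ (seriesVol ε α β γ δ) := by
  have hfin := ae_volSeries_ne_top (α := α) (γ := γ) (δ := δ) hε hreg hβ hβ1
  refine ⟨fun t => (measurable_volSeries_innovations hε t).ennreal_toReal, ?_, ?_, fun h => ?_⟩
  · filter_upwards [hfin] with ω hω t
    exact hα.trans_le (le_toReal_volSeries hα hβ hγ (hω t))
  · filter_upwards [hfin] with ω hω t
    have h := toReal_volSeries_succ hα hβ hγ (hω t)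
    have hshift : (fun k : ℕ => ε (t - 1 - ((k + 1 : ℕ) : ℤ)) ω) =
        fun k : ℕ => ε (t - 1 - 1 - k) ω := by
      funext k
      congr 1
      push_cast
      ring
    rw [hshift] at h
    simpa [seriesVol, volStep] using h
  · let Φ : (ℤ → ℝ) → ℤ → ℝ := fun e t => (volSeries α β γ δ fun k => e (t - 1 - k)).toReal
    have hΦ : Measurable Φ := measurable_pi_lambda _ fun t =>
      (measurable_volSeries.comp (measurable_pi_lambda _ fun k =>
        measurable_pi_apply _)).ennreal_toReal
    have hsh : IdentDistrib (fun ω t => ε (t + h) ω) (fun ω t => ε t ω) P P := by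
      refine ⟨(measurable_pi_lambda _ fun t => hε.measurable _).aemeasurable,
        (measurable_pi_lambda _ fun t => hε.measurable _).aemeasurable, ?_⟩
      rw [map_innovations hε (f := fun t : ℤ => t + h) (add_left_injective h),
        map_innovations hε (f := fun t : ℤ => t) Function.injective_id]
    have hcomp := hsh.comp hΦ
    have h1 : (Φ ∘ fun ω t => ε (t + h) ω) = fun ω t => seriesVol ε α β γ δ (t + h) ω := by
      funext ω t
      simp only [Φ, Function.comp, seriesVol]
      congr 2
      funext k
      congr 1
      ring
    rw [h1] at hcomp
    exact hcomp

lemma tendsto_integral_min (hβ : 0 < β) (hβ1 : β < 1) {f : Ω → ℝ} (hf : Measurable f) :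
    Tendsto (fun n : ℕ => ∫ ω, min 1 |β ^ n * f ω| ∂P) atTop (𝓝 0) := by
  have h0 : ∫ _ω : Ω, min 1 |0 * (0 : ℝ)| ∂P = 0 := by simp
  rw [← h0]
  refine tendsto_integral_of_dominated_convergence (fun _ => 1)
    (fun n => by fun_prop) (integrable_const _)
    (fun n => ae_of_all _ fun ω => ?_) (ae_of_all _ fun ω => ?_)
  · rw [Real.norm_of_nonneg (le_min zero_le_one (abs_nonneg _))]
    exact min_le_left _ _
  · have h1 := (tendsto_pow_atTop_nhds_zero_of_lt_one hβ.le hβ1).mul_const (f ω)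
    have h2 := (tendsto_const_nhds (x := (1 : ℝ))).min h1.abs
    simpa using h2

/-- Two strictly stationary solutions agree almost surely at time `0`. -/
lemma stationary_unique (hβ : 0 < β) (hβ1 : β < 1) (hv : IsStationaryVGARCH P ε α β γ δ v)
    (hv' : IsStationaryVGARCH P ε α β γ δ v') : v 0 =ᵐ[P] v' 0 := by
  -- The innovations cancel in the difference, and stationarity makes `β ^ n * v (-n)` tend to `0`
  -- in probability.
  have hdiff : ∀ᵐ ω ∂P, ∀ n : ℕ, v 0 ω - v' 0 ω = β ^ n * v (-n) ω - β ^ n * v' (-n) ω := by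
    filter_upwards [hv.evolution, hv'.evolution] with ω h h' n
    induction n with
    | zero => simp
    | succ n ih =>
      rw [ih, h (-n), h' (-n)]
      have : (-(n : ℤ) - 1) = -((n + 1 : ℕ) : ℤ) := by push_cast; ring
      rw [this]
      ring
  have hmeas := hv.measurable
  have hmeas' := hv'.measurable
  have hint : ∀ f : Ω → ℝ, Measurable f → Integrable (fun ω => min 1 |f ω|) P := by
    intro f hf
    refine Integrable.of_bound (by fun_prop) 1 (ae_of_all _ fun ω => ?_)
    rw [Real.norm_of_nonneg (le_min zero_le_one (abs_nonneg _))]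
    exact min_le_left _ _
  have hle : ∀ n : ℕ, ∫ ω, min 1 |v 0 ω - v' 0 ω| ∂P ≤
      ∫ ω, min 1 |β ^ n * v 0 ω| ∂P + ∫ ω, min 1 |β ^ n * v' 0 ω| ∂P := by
    intro n
    have hi := hint (fun ω => β ^ n * v (-n) ω) ((hmeas _).const_mul _)
    have hi' := hint (fun ω => β ^ n * v' (-n) ω) ((hmeas' _).const_mul _)
    rw [← integral_min_stationary hv, ← integral_min_stationary hv', ← integral_add hi hi']
    refine integral_mono_ae (hint _ ((hmeas 0).sub (hmeas' 0))) (hi.add hi') ?_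
    filter_upwards [hdiff] with ω hω
    rw [hω n]
    have h1 := abs_sub (β ^ n * v (-n) ω) (β ^ n * v' (-n) ω)
    have h2 := abs_nonneg (β ^ n * v (-n) ω)
    have h3 := abs_nonneg (β ^ n * v' (-n) ω)
    rcases le_total 1 |β ^ n * v (-n) ω| with ha | ha
    · rw [min_eq_left ha]
      exact (min_le_left _ _).trans (le_add_of_nonneg_right (le_min zero_le_one h3))
    rcases le_total 1 |β ^ n * v' (-n) ω| with hb | hb
    · rw [min_eq_left hb]
      exact (min_le_left _ _).trans (le_add_of_nonneg_left (le_min zero_le_one h2))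
    rw [min_eq_right ha, min_eq_right hb]
    exact (min_le_right _ _).trans h1
  have hlim := (tendsto_integral_min (P := P) hβ hβ1 (hmeas 0)).add
    (tendsto_integral_min (P := P) hβ hβ1 (hmeas' 0))
  have h0 := ge_of_tendsto' hlim hle
  rw [add_zero] at h0
  have hnn : ∀ ω, 0 ≤ min 1 |v 0 ω - v' 0 ω| := fun ω => le_min zero_le_one (abs_nonneg _)
  have hae := (integral_eq_zero_iff_of_nonneg hnn (hint _ ((hmeas 0).sub (hmeas' 0)))).1
    (le_antisymm h0 (integral_nonneg hnn))
  filter_upwards [hae] with ω hω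
  have hω' : min 1 |v 0 ω - v' 0 ω| = 0 := hω
  by_contra hne
  exact (lt_min one_pos (abs_pos.2 (sub_ne_zero.2 hne))).ne' hω'

/-- The volatility at time `0` is independent of the innovations from time `0` on. -/
lemma indepFun_vol_future (hε : IsIIDInnovations P ε) (hreg : RegularInnovation P (ε 0))
    (hα : 0 < α) (hβ : 0 < β) (hβ1 : β < 1) (hγ : 0 ≤ γ)
    (hv : IsStationaryVGARCH P ε α β γ δ v) :
    IndepFun (v 0) (fun ω (t : ℕ) => ε t ω) P := by
  -- The series at time `0` uses only the innovations at times `-1, -2, …`, and `v 0` agrees with it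
  -- almost surely by uniqueness.
  have h := indepFun_blocks hε (fun k : ℕ => (0 : ℤ) - 1 - k) (fun k : ℕ => (k : ℤ))
    (fun i j => by omega)
  have h2 := h.comp (measurable_volSeries (α := α) (β := β) (γ := γ) (δ := δ)).ennreal_toReal
    measurable_id
  refine h2.congr ?_ (ae_eq_refl _)
  exact stationary_unique hβ hβ1 (isStationaryVGARCH_seriesVol hε hreg hα hβ hβ1 hγ) hv

end Innovations

/-! ### Trajectories of the two-point motion -/

/-- One step of the two-point motion together with the shift of the future innovations. -/
noncomputable def skewShift (α β γ δ : ℝ) (z : (ℝ × ℝ) × (ℕ → ℝ)) : (ℝ × ℝ) × (ℕ → ℝ) :=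
  (pairStep α β γ δ z.1 (z.2 0), fun n => z.2 (n + 1))

section Trajectory

variable {α β γ δ : ℝ}

lemma measurable_skewShift (hα : 0 < α) : Measurable (skewShift α β γ δ) := by
  refine Measurable.prodMk ((measurable_pairStep hα).comp (by fun_prop :
    Measurable fun z : (ℝ × ℝ) × (ℕ → ℝ) => (z.1, z.2 0))) ?_
  fun_prop

lemma skewShift_iterate_snd (z : (ℝ × ℝ) × (ℕ → ℝ)) (t n : ℕ) :
    ((skewShift α β γ δ)^[t] z).2 n = z.2 (n + t) := by
  induction t generalizing n with
  | zero => rfl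
  | succ t ih =>
    rw [Function.iterate_succ_apply']
    change ((skewShift α β γ δ)^[t] z).2 (n + 1) = _
    rw [ih, add_right_comm, add_assoc]

lemma skewShift_iterate_succ_fst (z : (ℝ × ℝ) × (ℕ → ℝ)) (t : ℕ) :
    ((skewShift α β γ δ)^[t + 1] z).1 =
      pairStep α β γ δ ((skewShift α β γ δ)^[t] z).1 (z.2 t) := by
  rw [Function.iterate_succ_apply']
  simp only [skewShift]
  rw [← zero_add t, ← skewShift_iterate_snd (α := α) (β := β) (γ := γ) (δ := δ)]
  simp [skewShift_iterate_snd]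

lemma skewShift_iterate_mem_quadrant (hα : 0 < α) (hβ : 0 < β) (hγ : 0 ≤ γ)
    {z : (ℝ × ℝ) × (ℕ → ℝ)} (hz : z.1 ∈ quadrant α) (t : ℕ) :
    ((skewShift α β γ δ)^[t] z).1 ∈ quadrant α := by
  induction t with
  | zero => exact hz
  | succ t ih =>
    rw [skewShift_iterate_succ_fst]
    exact pairStep_mem_quadrant hα hβ hγ ih _

/-- An invariant law of the two-point motion, with independent future innovations, is invariant
under the skew shift. -/
lemma measurePreserving_skewShift (hα : 0 < α) {ρ : Measure ℝ} [IsProbabilityMeasure ρ]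
    {l : Measure (ℕ → ℝ)} [IsProbabilityMeasure l]
    (hl : MeasurePreserving (fun e : ℕ → ℝ => (e 0, fun n => e (n + 1))) l (ρ.prod l))
    {ν : Measure (ℝ × ℝ)} [IsProbabilityMeasure ν] (hν : push ρ α β γ δ ν = ν) :
    MeasurePreserving (skewShift α β γ δ) (ν.prod l) (ν.prod l) := by
  have hT : MeasurePreserving (fun p : (ℝ × ℝ) × ℝ => pairStep α β γ δ p.1 p.2)
      (ν.prod ρ) ν := ⟨measurable_pairStep hα, hν⟩
  have h1 := (MeasurePreserving.id ν).prod hl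
  have h2 := (measurePreserving_prodAssoc ν ρ l).symm
  have h3 := hT.prod (MeasurePreserving.id l)
  exact h3.comp (h2.comp h1)

end Trajectory

/-! ### The stationary law of the volatility and its drift along the diagonal -/

section Innovations

variable {Ω : Type u} [MeasurableSpace Ω] {P : Measure Ω}
  {ε : ℤ → Ω → ℝ} {α β γ δ : ℝ} {v : ℤ → Ω → ℝ}

lemma tailBoundedDensity (hreg : RegularInnovation P (ε 0)) :
    ∃ M, 0 ≤ M ∧ TailBoundedDensity (P.map (ε 0)) M := by
  obtain ⟨g, hg, hpos, ⟨M, hM⟩, hmap⟩ := hreg.exists_density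
  have hM' : ∀ x, (|x| + 1) * g x ≤ M := fun x => hM (mem_range_self x)
  refine ⟨M, ?_, g, hg.measurable, fun x => ?_, hmap⟩
  · exact (mul_nonneg (by positivity) (hpos 0).le).trans (hM' 0)
  · refine le_trans ?_ (hM' x)
    have := hpos x
    gcongr
    linarith

lemma ae_le_vol (hβ : 0 < β) (hγ : 0 ≤ γ) (hv : IsStationaryVGARCH P ε α β γ δ v) :
    ∀ᵐ ω ∂P, α ≤ v 0 ω := by
  filter_upwards [hv.pos, hv.evolution] with ω h1 h2
  rw [h2 0]
  have := mul_nonneg hγ (sq_nonneg (ε (0 - 1) ω - δ))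
  have := mul_pos hβ (h1 (0 - 1))
  linarith

variable [IsProbabilityMeasure P]

lemma measurePreserving_split (hε : IsIIDInnovations P ε) :
    MeasurePreserving (fun e : ℕ → ℝ => (e 0, fun n => e (n + 1)))
      (P.map fun ω (t : ℕ) => ε t ω)
      ((P.map (ε 0)).prod (P.map fun ω (t : ℕ) => ε t ω)) := by
  have hsp : Measurable fun e : ℕ → ℝ => (e 0, fun n => e (n + 1)) := by fun_prop
  have hF : Measurable fun ω => fun t : ℕ => ε t ω :=
    measurable_pi_lambda _ fun t => hε.measurable t
  have hG : Measurable fun ω => fun t : ℕ => ε ((t : ℤ) + 1) ω :=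
    measurable_pi_lambda _ fun t => hε.measurable _
  refine ⟨hsp, ?_⟩
  rw [Measure.map_map hsp hF]
  have hind := indepFun_blocks hε (fun _ : Unit => (0 : ℤ)) (fun k : ℕ => (k : ℤ) + 1)
    (fun i j => by omega)
  have hind' : IndepFun (ε 0) (fun ω (t : ℕ) => ε ((t : ℤ) + 1) ω) P :=
    hind.comp (φ := fun x : Unit → ℝ => x ()) (ψ := id) (measurable_pi_apply _) measurable_id
  have h := (indepFun_iff_map_prod_eq_prod_map_map (hε.measurable 0).aemeasurable
    hG.aemeasurable).1 hind'
  have hlaw : P.map (fun ω (t : ℕ) => ε ((t : ℤ) + 1) ω) = P.map fun ω (t : ℕ) => ε t ω := by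
    rw [map_innovations hε (f := fun t : ℕ => (t : ℤ) + 1) (fun a b h => by simpa using h),
      map_innovations hε (f := fun t : ℕ => (t : ℤ)) Nat.cast_injective]
  rw [hlaw] at h
  rw [← h]
  congr 1

lemma indepFun_vol_innovation (hε : IsIIDInnovations P ε) (hreg : RegularInnovation P (ε 0))
    (hα : 0 < α) (hβ : 0 < β) (hβ1 : β < 1) (hγ : 0 ≤ γ)
    (hv : IsStationaryVGARCH P ε α β γ δ v) : IndepFun (v 0) (ε 0) P :=
  (indepFun_vol_future hε hreg hα hβ hβ1 hγ hv).comp (φ := id) (ψ := fun e : ℕ → ℝ => e 0)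
    measurable_id (measurable_pi_apply 0)

/-- Independence of `v 0` and `ε 0` identifies the image law with that of `v 1`, which equals that
of `v 0` by stationarity. -/
lemma volPush_map_vol (hε : IsIIDInnovations P ε) (hreg : RegularInnovation P (ε 0))
    (hα : 0 < α) (hβ : 0 < β) (hβ1 : β < 1) (hγ : 0 ≤ γ)
    (hv : IsStationaryVGARCH P ε α β γ δ v) :
    volPush (P.map (ε 0)) α β γ δ (P.map (v 0)) = P.map (v 0) := by
  have hind := (indepFun_iff_map_prod_eq_prod_map_map (hv.measurable 0).aemeasurable
    (hε.measurable 0).aemeasurable).1 (indepFun_vol_innovation hε hreg hα hβ hβ1 hγ hv)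
  unfold volPush
  rw [← hind, Measure.map_map continuous_volStep.measurable
    ((hv.measurable 0).prodMk (hε.measurable 0))]
  have h1 : ((fun p : ℝ × ℝ => volStep α β γ δ p.1 p.2) ∘ fun ω => (v 0 ω, ε 0 ω)) =ᵐ[P]
      v 1 := by
    filter_upwards [hv.evolution] with ω h
    rw [h 1]
    simp [volStep]
  rw [Measure.map_congr h1]
  have h2 := (hv.stationary 1).comp (u := fun x : ℤ → ℝ => x 0) (measurable_pi_apply 0)
  simpa [Function.comp_def] using h2.map_eq

/-- The stability coefficient is the mean drift along the diagonal. -/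
lemma stabilityCoeff_eq_integral_drift (hε : IsIIDInnovations P ε)
    (hreg : RegularInnovation P (ε 0)) (hid : Integrable (fun x => x) (P.map (ε 0)))
    (hα : 0 < α) (hβ : 0 < β) (hβ1 : β < 1) (hγ : 0 ≤ γ)
    (hv : IsStationaryVGARCH P ε α β γ δ v) :
    vgarchStabilityCoeff P (ε 0) (v 0) β γ δ =
      ∫ x, drift (P.map (ε 0)) α β γ δ (x, x) ∂(P.map (v 0)) := by
  obtain ⟨M, hM, hρ⟩ := tailBoundedDensity hreg
  have : IsProbabilityMeasure (P.map (ε 0)) :=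
    Measure.isProbabilityMeasure_map (hε.measurable 0).aemeasurable
  have hvm := hv.measurable 0
  have hpm : Measurable fun ω => (v 0 ω, v 0 ω) := hvm.prodMk hvm
  have : IsProbabilityMeasure (P.map fun ω => (v 0 ω, v 0 ω)) :=
    Measure.isProbabilityMeasure_map hpm.aemeasurable
  have hind : IndepFun (fun ω => (v 0 ω, v 0 ω)) (ε 0) P :=
    (indepFun_vol_innovation hε hreg hα hβ hβ1 hγ hv).comp (φ := fun x : ℝ => (x, x))
      (ψ := id) (by fun_prop) measurable_id
  have hmap := (indepFun_iff_map_prod_eq_prod_map_map hpm.aemeasurable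
    (hε.measurable 0).aemeasurable).1 hind
  -- Applied to the law of `(v 0, v 0)`, which sits on the diagonal, where the growth factor is the
  -- derivative appearing in the stability coefficient.
  have hg := integral_log_growth (m := P.map fun ω => (v 0 ω, v 0 ω)) (δ := δ) hM hρ hid hα hβ hγ
  have hdc := continuous_drift (γ := γ) (δ := δ) hM hρ hid hα hβ
  have hint := hg.1
  have hval := hg.2
  rw [← hmap] at hint hval
  rw [integral_map (hpm.prodMk (hε.measurable 0)).aemeasurable hint.aestronglyMeasurable,
    integral_map hpm.aemeasurable hdc.measurable.aestronglyMeasurable] at hval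
  have hdc' : Continuous fun x => drift (P.map (ε 0)) α β γ δ (x, x) :=
    hdc.comp (by fun_prop : Continuous fun x : ℝ => (x, x))
  rw [integral_map hvm.aemeasurable hdc'.measurable.aestronglyMeasurable, ← hval]
  refine integral_congr_ae ?_
  filter_upwards [ae_le_vol hβ hγ hv] with ω hω
  rw [diag_growth hα hβ hγ hω, Real.log_abs]

end Innovations

/-! ### Extending the probability space -/

section Extension

variable {Ω : Type u} [MeasurableSpace Ω] {P : Measure Ω} [IsProbabilityMeasure P]

/-- If `X` is independent of `F`, then a second coordinate sampled from the conditional law of `ν`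
given `X` makes `(X, Y)` of law `ν` and independent of `F`. -/
lemma map_compProd_condKernel {F : Ω → ℕ → ℝ} (hF : Measurable F) {X : Ω → ℝ}
    (hX : Measurable X) (hind : IndepFun X F P) {ν : Measure (ℝ × ℝ)} [IsProbabilityMeasure ν]
    (hν : ν.map Prod.fst = P.map X) :
    (P ⊗ₘ (ν.condKernel.comap X hX)).map (fun q : Ω × ℝ => ((X q.1, q.2), F q.1)) =
      ν.prod (P.map F) := by
  have : IsProbabilityMeasure (P.map F) := Measure.isProbabilityMeasure_map hF.aemeasurable
  have hm : Measurable fun q : Ω × ℝ => ((X q.1, q.2), F q.1) := by fun_prop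
  refine (Measure.prod_eq fun U C hU hC => ?_).symm
  rw [Measure.map_apply hm (hU.prod hC), Measure.compProd_apply (hm (hU.prod hC))]
  set k : ℝ → ENNReal := fun x => ν.condKernel x (Prod.mk x ⁻¹' U) with hk
  have hkm : Measurable k := Kernel.measurable_kernel_prodMk_left hU
  have h1 : ∀ ω, (ν.condKernel.comap X hX) ω (Prod.mk ω ⁻¹'
      ((fun q : Ω × ℝ => ((X q.1, q.2), F q.1)) ⁻¹' U ×ˢ C)) =
      k (X ω) * (C.indicator 1) (F ω) := by
    intro ω
    rw [Kernel.comap_apply]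
    by_cases hω : F ω ∈ C
    · simp only [hω, indicator_of_mem, Pi.one_apply, mul_one, hk]
      congr 1
      ext y
      simp [hω]
    · simp only [hω, not_false_eq_true, indicator_of_notMem, mul_zero]
      convert measure_empty (μ := ν.condKernel (X ω))
      ext y
      simp [hω]
  simp_rw [h1]
  have hind' := hind.comp hkm (measurable_one.indicator hC : Measurable (C.indicator
    (1 : (ℕ → ℝ) → ENNReal)))
  have h2 := lintegral_mul_eq_lintegral_mul_lintegral_of_indepFun (hkm.comp hX)
    ((measurable_one.indicator hC).comp hF) hind'
  simp only [Pi.mul_apply, Function.comp] at h2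
  rw [h2]
  congr 1
  · rw [← lintegral_map hkm hX, ← hν]
    conv_rhs => rw [← ν.disintegrate ν.condKernel, Measure.compProd_apply hU]
    rfl
  · rw [← lintegral_map (measurable_one.indicator hC) hF, lintegral_indicator_one hC]

end Extension

/-- From an invariant law of the two-point motion off the diagonal to a second solution of the
system on an extension of the probability space. -/
lemma exists_second_solution {Ω : Type u} [MeasurableSpace Ω] {P : Measure Ω}
    [IsProbabilityMeasure P] {ε : ℤ → Ω → ℝ} (hε : IsIIDInnovations P ε) {α β γ δ : ℝ}
    (hα : 0 < α) (hβ : 0 < β) (hγ : 0 ≤ γ) {v : ℤ → Ω → ℝ}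
    (hv : IsStationaryVGARCH P ε α β γ δ v)
    (hind : IndepFun (v 0) (fun ω (t : ℕ) => ε t ω) P)
    {ν : Measure (ℝ × ℝ)} [IsProbabilityMeasure ν] (hfst : ν.map Prod.fst = P.map (v 0))
    (hq : ∀ᵐ x ∂ν, x ∈ quadrant α) (hinv : push (P.map (ε 0)) α β γ δ ν = ν)
    (hne : ∀ᵐ x ∂ν, x.1 ≠ x.2) :
    ∃ (Ω' : Type u) (_ : MeasurableSpace Ω') (P' : Measure Ω') (p : Ω' → Ω)
      (w : ℕ → Ω' → ℝ),
      IsProbabilityMeasure P' ∧ MeasurePreserving p P' P ∧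
      IsVGARCHSystemSolution P' (fun t ω => ε (t : ℤ) (p ω)) α β γ δ
        (fun t ω => v (t : ℤ) (p ω)) w ∧
      IsStrictlyStationary (fun (t : ℕ) ω => (v (t : ℤ) (p ω), w t ω)) P' ∧
      P' {ω | v 0 (p ω) = w 0 ω} = 0 := by
  have hv0 := hv.measurable 0
  have hF : Measurable fun ω => fun t : ℕ => ε t ω :=
    measurable_pi_lambda _ fun t => hε.measurable t
  have : IsProbabilityMeasure (P.map (ε 0)) :=
    Measure.isProbabilityMeasure_map (hε.measurable 0).aemeasurable
  set l := P.map fun ω (t : ℕ) => ε t ω with hl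
  have : IsProbabilityMeasure l := Measure.isProbabilityMeasure_map hF.aemeasurable
  set P' : Measure (Ω × ℝ) := P ⊗ₘ (ν.condKernel.comap (v 0) hv0) with hP'
  set Z : Ω × ℝ → (ℝ × ℝ) × (ℕ → ℝ) := fun q => ((v 0 q.1, q.2), fun t : ℕ => ε t q.1) with hZ
  have hZm : Measurable Z := by
    have hF' : Measurable fun q : Ω × ℝ => fun t : ℕ => ε t q.1 := hF.comp measurable_fst
    exact ((hv0.comp measurable_fst).prodMk measurable_snd).prodMk hF'
  have hZmap : P'.map Z = ν.prod l := map_compProd_condKernel hF hv0 hind hfst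
  have hp : MeasurePreserving (Prod.fst : Ω × ℝ → Ω) P' P := 
    ⟨measurable_fst, Measure.fst_compProd _ _⟩
  have hS : MeasurePreserving (skewShift α β γ δ) (ν.prod l) (ν.prod l) :=
    measurePreserving_skewShift hα (measurePreserving_split hε) hinv
  set x : ℕ → Ω × ℝ → ℝ × ℝ := fun t q => ((skewShift α β γ δ)^[t] (Z q)).1 with hx
  have hxm : ∀ t, Measurable (x t) := fun t =>
    measurable_fst.comp (((measurable_skewShift hα).iterate t).comp hZm)
  have hquad : ∀ᵐ q ∂P', ∀ t, x t q ∈ quadrant α := by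
    have h0 : ∀ᵐ z ∂(P'.map Z), z.1 ∈ quadrant α := by
      rw [hZmap]
      exact Measure.quasiMeasurePreserving_fst.ae hq
    filter_upwards [ae_of_ae_map hZm.aemeasurable h0] with q hq0 t
    exact skewShift_iterate_mem_quadrant hα hβ hγ hq0 t
  -- Both sides start at `v 0` and obey the same recursion with the same innovations.
  have hx1 : ∀ᵐ q ∂P', ∀ t : ℕ, (x t q).1 = v t q.1 := by
    filter_upwards [hp.quasiMeasurePreserving.ae hv.evolution] with q hev t
    induction t with
    | zero => rfl
    | succ t ih =>
      have h1 := hev ((t + 1 : ℕ) : ℤ)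
      have h2 : (((t + 1 : ℕ) : ℤ) - 1) = t := by push_cast; ring
      rw [h2] at h1
      rw [h1, hx]
      simp only [skewShift_iterate_succ_fst]
      change volStep α β γ δ (x t q).1 (ε t q.1) = _
      rw [ih]
      rfl
  have hx2 : ∀ t q, x (t + 1) q = pairStep α β γ δ (x t q) (ε t q.1) := fun t q =>
    skewShift_iterate_succ_fst _ _
  refine ⟨Ω × ℝ, inferInstance, P', Prod.fst, fun t q => (x t q).2, inferInstance, hp, ?_, ?_, ?_⟩
  · refine ⟨fun t => (hv.measurable t).comp measurable_fst,
      fun t => measurable_snd.comp (hxm t), ?_, ?_, ?_, ?_⟩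
    · filter_upwards [hquad, hx1] with q h1 h2 t
      rw [← h2 t]
      exact ⟨hα.trans_le (h1 t).1, hα.trans_le (h1 t).2⟩
    · filter_upwards [hquad, hx1] with q h1 h2 t
      rw [← h2 t, ← h2 (t + 1), hx2, vgarchH_self (hα.trans_le (h1 t).1)]
      rfl
    · filter_upwards [hquad, hx1] with q h1 h2 t
      rw [← h2 t, hx2, pairStep_snd (h1 t).2]
    · have h1 : IndepFun (fun q => (Z q).1) (fun q => (Z q).2) P' := by
        refine (indepFun_iff_map_prod_eq_prod_map_map (measurable_fst.comp hZm).aemeasurable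
          (measurable_snd.comp hZm).aemeasurable).2 ?_
        have e1 : P'.map (fun q => (Z q).1) = ν := by
          rw [← Measure.fst_prod (μ := ν) (ν := l), ← hZmap]
          exact (Measure.map_map measurable_fst hZm).symm
        have e2 : P'.map (fun q => (Z q).2) = l := by
          rw [← Measure.snd_prod (μ := ν) (ν := l), ← hZmap]
          exact (Measure.map_map measurable_snd hZm).symm
        change P'.map Z = (P'.map fun q => (Z q).1).prod (P'.map fun q => (Z q).2)
        rw [e1, e2, hZmap]
      exact h1
  · intro h
    have hG : Measurable fun z : (ℝ × ℝ) × (ℕ → ℝ) => fun t : ℕ =>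
        ((skewShift α β γ δ)^[t] z).1 := measurable_pi_lambda _ fun t =>
      measurable_fst.comp ((measurable_skewShift hα).iterate t)
    -- Shifting time by `k` amounts to starting the trajectory from the `k`-th iterate of the skew
    -- shift, which preserves the law of `Z`.
    have hae : ∀ k : ℕ, (fun q (t : ℕ) => (v ((t + k : ℕ) : ℤ) q.1, (x (t + k) q).2)) =ᵐ[P']
        (fun z (t : ℕ) => ((skewShift α β γ δ)^[t] z).1) ∘ (skewShift α β γ δ)^[k] ∘ Z := by
      intro k
      filter_upwards [hx1] with q hq1
      funext t
      rw [← hq1 (t + k)]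
      simp only [hx, Function.comp, ← Function.iterate_add_apply]
    have hlaw : ∀ k : ℕ,
        P'.map (fun q (t : ℕ) => (v ((t + k : ℕ) : ℤ) q.1, (x (t + k) q).2)) =
          (ν.prod l).map fun z (t : ℕ) => ((skewShift α β γ δ)^[t] z).1 := by
      intro k
      rw [Measure.map_congr (hae k), ← Measure.map_map hG
        (((measurable_skewShift hα).iterate k).comp hZm), ← Measure.map_map
        ((measurable_skewShift hα).iterate k) hZm, hZmap, (hS.iterate k).map_eq]
    have hm : ∀ k : ℕ, Measurable fun (q : Ω × ℝ) (t : ℕ) =>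
        (v ((t + k : ℕ) : ℤ) q.1, (x (t + k) q).2) := fun k =>
      measurable_pi_lambda _ fun t => ((hv.measurable _).comp measurable_fst).prodMk
        (measurable_snd.comp (hxm _))
    exact ⟨(hm h).aemeasurable, (hm 0).aemeasurable, (hlaw h).trans (hlaw 0).symm⟩
  · have h0 : ∀ᵐ z ∂(P'.map Z), z.1.1 ≠ z.1.2 := by
      rw [hZmap]
      exact Measure.quasiMeasurePreserving_fst.ae hne
    have h1 := ae_of_ae_map hZm.aemeasurable h0
    rw [ae_iff] at h1
    simp only [ne_eq, not_not] at h1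
    exact h1

end VGARCH

theorem mainTheorem2 {Ω : Type u} [MeasurableSpace Ω] (P : Measure Ω)
    [IsProbabilityMeasure P] (ε : ℤ → Ω → ℝ) (hε : IsIIDInnovations P ε)
    (α β γ δ : ℝ) (hα : 0 < α) (hβ : 0 < β) (hγ : 0 ≤ γ)
    (hstat : VGARCHStationarityCondition P (ε 0) α β γ δ)
    (hreg : RegularInnovation P (ε 0)) :
    (∃ v : ℤ → Ω → ℝ, IsStationaryVGARCH P ε α β γ δ v) ∧
    ∀ v : ℤ → Ω → ℝ, IsStationaryVGARCH P ε α β γ δ v →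
      0 < vgarchStabilityCoeff P (ε 0) (v 0) β γ δ →
      -- an extension `(Ω', P')` of `(Ω, P)`, with projection `p`, carrying the process `w = σ̂²`
      ∃ (Ω' : Type u) (_ : MeasurableSpace Ω') (P' : Measure Ω') (p : Ω' → Ω)
        (w : ℕ → Ω' → ℝ),
        IsProbabilityMeasure P' ∧ MeasurePreserving p P' P ∧
        IsVGARCHSystemSolution P' (fun t ω => ε (t : ℤ) (p ω)) α β γ δ
          (fun t ω => v (t : ℤ) (p ω)) w ∧
        IsStrictlyStationary (fun (t : ℕ) ω => (v (t : ℤ) (p ω), w t ω)) P' ∧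
        P' {ω | v 0 (p ω) = w 0 ω} = 0 := by

  have hβ1 := hstat.beta_lt_one
  refine ⟨⟨_, VGARCH.isStationaryVGARCH_seriesVol hε hreg hα hβ hβ1 hγ⟩, fun v hv hpos => ?_⟩
  have hε0 := (hε.measurable 0).aemeasurable (μ := P)
  have : IsProbabilityMeasure (P.map (ε 0)) := Measure.isProbabilityMeasure_map hε0
  have : IsProbabilityMeasure (P.map (v 0)) :=
    Measure.isProbabilityMeasure_map (hv.measurable 0).aemeasurable
  obtain ⟨M, hM, hρ⟩ := VGARCH.tailBoundedDensity hreg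
  have hid : Integrable (fun x => x) (P.map (ε 0)) :=
    (integrable_map_measure aestronglyMeasurable_id hε0).2
      (hreg.memLp_two.integrable one_le_two)
  have hsqm : AEStronglyMeasurable (fun x : ℝ => x ^ 2) (P.map (ε 0)) := by fun_prop
  have hsq : Integrable (fun x => x ^ 2) (P.map (ε 0)) :=
    (integrable_map_measure hsqm hε0).2 hreg.memLp_two.integrable_sq
  have hsq1 : ∫ x, x ^ 2 ∂(P.map (ε 0)) = 1 := by
    rw [integral_map hε0 hsqm, hreg.second_moment_eq_one]
  -- Integrability is not assumed of `v`; it is inherited from the series solution through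
  -- uniqueness.
  have hμ : Integrable (fun x => x) (P.map (v 0)) :=
    (integrable_map_measure aestronglyMeasurable_id (hv.measurable 0).aemeasurable).2
      ((VGARCH.integrable_seriesVol hε hreg hβ hβ1 0).congr (VGARCH.stationary_unique hβ hβ1
        (VGARCH.isStationaryVGARCH_seriesVol hε hreg hα hβ hβ1 hγ) hv))
  have hμα : ∀ᵐ x ∂(P.map (v 0)), α ≤ x :=
    (ae_map_iff (hv.measurable 0).aemeasurable measurableSet_Ici).2 (VGARCH.ae_le_vol hβ hγ hv)
  rw [VGARCH.stabilityCoeff_eq_integral_drift hε hreg hid hα hβ hβ1 hγ hv] at hpos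
  obtain ⟨ν, hνp, hfst, hq, hinv, hne⟩ := VGARCH.exists_invariant_off_diag hM hρ hid hsq hsq1
    hα hβ hβ1 hγ hμ hμα (VGARCH.volPush_map_vol hε hreg hα hβ hβ1 hγ hv) hpos
  exact VGARCH.exists_second_solution hε hα hβ hγ hv
    (VGARCH.indepFun_vol_future hε hreg hα hβ hβ1 hγ hv) hfst hq hinv hne
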